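/- **Theorem ($\mathcal F_{19}$, real).** For $p,q\ge 0$ let $O(p,q)$ be the group of real $(p+q)\times(p+q)$ matrices $G$ with $G^T I_{p,q}G=I_{p,q}$, $I_{p,q}=\mathrm{diag}(I_p,-I_q)$. For $m\ge n$ and $\theta\in\mathbb R^n$ let $$H_{m,n}^\theta=\begin{bmatrix}Ch&0&Sh\\0&I_{m-n}&0\\Sh&0&Ch\end{bmatrix},\qquad Ch=\mathrm{diag}(\cosh\theta_1,\dots,\cosh\theta_n),\quad Sh=\mathrm{diag}(\sinh\theta_1,\dots,\sinh\theta_n).$$ Let $p=p_1+p_2$, $q=q_1+q_2$ with integers $p_1,p_2,q_1,q_2\ge 0$, and define the permutation matrices $$P_1=\begin{bmatrix}I_{p_1}&0&0&0\\0&0&I_{q_1}&0\\0&I_{p_2}&0&0\\0&0&0&I_{q_2}\end{bmatrix},\qquad P_2=\begin{bmatrix}I_{p_1}&0&0&0\\0&0&0&I_{q_2}\\0&I_{p_2}&0&0\\0&0&I_{q_1}&0\end{bmatrix}.$$ Let $m_1=\min(p_1,q_2)$ and $m_2=\min(p_2,q_1)$. For every $O\in O(p,q)$ there exist orthogonal matrices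 $O_p\in O(p)$, $O_q\in O(q)$, indefinite orthogonal matrices $V_1\in O(p_1,q_1)$, $V_2\in O(p_2,q_2)$, and real vectors $\theta\in\mathbb R^{m_1}$, $\gamma\in\mathbb R^{m_2}$ such that $$O=\begin{bmatrix}O_p&\\&O_q\end{bmatrix}\;P_2^T\begin{bmatrix}H^\theta_{\max(p_1,q_2),m_1}&\\&H^\gamma_{\max(p_2,q_1),m_2}\end{bmatrix}P_2\;P_1^T\begin{bmatrix}V_1&\\&V_2\end{bmatrix}P_1 .$$ Moreover $\theta$ and $\gamma$ are unique up to permutation and sign: vectors $\theta'\in\mathbb R^{m_1}$, $\gamma'\in\mathbb R^{m_2}$ occur in such a factorization of $O$ (with some $O_p,O_q,V_1,V_2$) if and only if $\theta'$ arises from $\theta$, and $\gamma'$ from $\gamma$, by permuting the entries and changing the signs of some of them. -/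

import Mathlib

open Matrix

noncomputable section

/-- The indefinite orthogonal group `O(p,q)`: the real `(p+q) × (p+q)` matrices `G` with
`Gᵀ I_{p,q} G = I_{p,q}`, where `I_{p,q} = diag(I_p, -I_q)`. -/
def indefiniteOrthogonal (p q : ℕ) : Set (Matrix (Fin p ⊕ Fin q) (Fin p ⊕ Fin q) ℝ) :=
  {G | Gᵀ * fromBlocks 1 0 0 (-1) * G = fromBlocks 1 0 0 (-1)}

/-- The permutation matrix `P₁` that sends `(x_{p₁}, x_{p₂}, x_{q₁}, x_{q₂})` to
`(x_{p₁}, x_{q₁}, x_{p₂}, x_{q₂})`. -/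
def permP₁ (p₁ p₂ q₁ q₂ : ℕ) :
    Matrix ((Fin p₁ ⊕ Fin q₁) ⊕ (Fin p₂ ⊕ Fin q₂)) (Fin (p₁ + p₂) ⊕ Fin (q₁ + q₂)) ℝ :=
  (fromBlocks
    (fromBlocks 1 0
                0 0) (fromBlocks 0 0
                                 1 0)
    (fromBlocks 0 1
                0 0) (fromBlocks 0 0
                                 0 1) :
    Matrix ((Fin p₁ ⊕ Fin q₁) ⊕ (Fin p₂ ⊕ Fin q₂)) ((Fin p₁ ⊕ Fin p₂) ⊕ (Fin q₁ ⊕ Fin q₂)) ℝ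
    ).submatrix id (Sum.map finSumFinEquiv.symm finSumFinEquiv.symm)

/-- The permutation matrix `P₂` that sends `(x_{p₁}, x_{p₂}, x_{q₁}, x_{q₂})` to
`(x_{p₁}, x_{q₂}, x_{p₂}, x_{q₁})`. -/
def permP₂ (p₁ p₂ q₁ q₂ : ℕ) :
    Matrix ((Fin p₁ ⊕ Fin q₂) ⊕ (Fin p₂ ⊕ Fin q₁)) (Fin (p₁ + p₂) ⊕ Fin (q₁ + q₂)) ℝ :=
  (fromBlocks
    (fromBlocks 1 0
                0 0) (fromBlocks 0 0
                                 0 1)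
    (fromBlocks 0 1
                0 0) (fromBlocks 0 0
                                 1 0) :
    Matrix ((Fin p₁ ⊕ Fin q₂) ⊕ (Fin p₂ ⊕ Fin q₁)) ((Fin p₁ ⊕ Fin p₂) ⊕ (Fin q₁ ⊕ Fin q₂)) ℝ
    ).submatrix id (Sum.map finSumFinEquiv.symm finSumFinEquiv.symm)

/-- The hyperbolic block rotation `H_{m,n}^θ` (for `n ≤ m`), with diagonal blocks `Ch`, `I_{m-n}`,
`Ch` and the corner blocks `Sh`. -/
def hyperbolicBlockRotation (m n : ℕ) (θ : Fin n → ℝ) :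
    Matrix ((Fin n ⊕ Fin (m - n)) ⊕ Fin n) ((Fin n ⊕ Fin (m - n)) ⊕ Fin n) ℝ :=
  fromBlocks
    (fromBlocks (diagonal fun i => Real.cosh (θ i)) 0 0 1)
    (fromRows (diagonal fun i => Real.sinh (θ i)) 0)
    (fromCols (diagonal fun i => Real.sinh (θ i)) 0)
    (diagonal fun i => Real.cosh (θ i))

/-- The order-preserving identification of the `a + b` indices, split as `a` and `b`, with the same
indices split as `min a b`, `max a b - min a b`, `min a b`. -/
def hyperbolicIndexEquiv (a b : ℕ) :
    Fin a ⊕ Fin b ≃ (Fin (min a b) ⊕ Fin (max a b - min a b)) ⊕ Fin (min a b) :=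
  finSumFinEquiv.trans
    ((finCongr (by omega : a + b = (min a b + (max a b - min a b)) + min a b)).trans
      (finSumFinEquiv.symm.trans (Equiv.sumCongr finSumFinEquiv.symm (Equiv.refl _))))

/-- The matrix `H_{max(a,b), min(a,b)}^θ`, with its `a + b` rows and columns split as `a` and `b`. -/
def hyperbolicH (a b : ℕ) (θ : Fin (min a b) → ℝ) :
    Matrix (Fin a ⊕ Fin b) (Fin a ⊕ Fin b) ℝ :=
  (hyperbolicBlockRotation (max a b) (min a b) θ).submatrix
    (hyperbolicIndexEquiv a b) (hyperbolicIndexEquiv a b)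

/-- Two real vectors agree up to permutation of the entries and sign changes of the entries. -/
def EqUpToPermSign {k : ℕ} (θ θ' : Fin k → ℝ) : Prop :=
  ∃ (σ : Equiv.Perm (Fin k)) (ε : Fin k → ℤˣ), ∀ i, θ' i = ((ε i : ℤ) : ℝ) * θ (σ i)

/-- The matrix `O` factors as
`diag(O_p, O_q) · P₂ᵀ diag(H^θ, H^γ) P₂ · P₁ᵀ diag(V₁, V₂) P₁` with the parameters `θ`, `γ`, for
some `O_p ∈ O(p)`, `O_q ∈ O(q)`, `V₁ ∈ O(p₁,q₁)`, `V₂ ∈ O(p₂,q₂)`, where `p = p₁ + p₂` and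
`q = q₁ + q₂`. -/
def HasFactorization {p₁ p₂ q₁ q₂ : ℕ}
    (O : Matrix (Fin (p₁ + p₂) ⊕ Fin (q₁ + q₂)) (Fin (p₁ + p₂) ⊕ Fin (q₁ + q₂)) ℝ)
    (θ : Fin (min p₁ q₂) → ℝ) (γ : Fin (min p₂ q₁) → ℝ) : Prop :=
  ∃ Op ∈ orthogonalGroup (Fin (p₁ + p₂)) ℝ, ∃ Oq ∈ orthogonalGroup (Fin (q₁ + q₂)) ℝ,
  ∃ V₁ ∈ indefiniteOrthogonal p₁ q₁, ∃ V₂ ∈ indefiniteOrthogonal p₂ q₂,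
    O = fromBlocks Op 0 0 Oq *
      ((permP₂ p₁ p₂ q₁ q₂)ᵀ * fromBlocks (hyperbolicH p₁ q₂ θ) 0 0 (hyperbolicH p₂ q₁ γ) *
        permP₂ p₁ p₂ q₁ q₂) *
      ((permP₁ p₁ p₂ q₁ q₂)ᵀ * fromBlocks V₁ 0 0 V₂ * permP₁ p₁ p₂ q₁ q₂)

end

open Matrix

/-- The exponential of a matrix that is skew for the form `J` preserves `J`. -/
theorem exp_preserves_form {n : Type*} [Fintype n] [DecidableEq n] {J X : Matrix n n ℝ}
    (hJ : IsUnit J) (hX : Xᵀ * J = -(J * X)) :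
    (NormedSpace.exp X)ᵀ * J * NormedSpace.exp X = J := by
  have hdet : IsUnit J.det := (Matrix.isUnit_iff_isUnit_det J).1 hJ
  have h1 : Xᵀ = J * (-X) * J⁻¹ := by
    rw [mul_neg, ← hX, Matrix.mul_assoc, Matrix.mul_nonsing_inv _ hdet, Matrix.mul_one]
  rw [← Matrix.exp_transpose, h1, Matrix.exp_conj _ _ hJ, Matrix.exp_neg, Matrix.mul_assoc,
    Matrix.mul_assoc, Matrix.mul_assoc, Matrix.nonsing_inv_mul_cancel_left _ _ hdet,
    Matrix.nonsing_inv_mul _ ((Matrix.isUnit_iff_isUnit_det _).1 (Matrix.isUnit_exp X)),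
    Matrix.mul_one]

/-- First order condition for a linear functional that is maximal at `t = 0` along `exp (t X)`. -/
theorem linearMap_eq_zero_of_exp_le {𝔸 : Type*} [NormedRing 𝔸] [NormedAlgebra ℝ 𝔸]
    [FiniteDimensional ℝ 𝔸] (L : 𝔸 →ₗ[ℝ] ℝ) (X : 𝔸)
    (h : ∀ t : ℝ, L (NormedSpace.exp (t • X)) ≤ L 1) : L X = 0 := by
  have : CompleteSpace 𝔸 := FiniteDimensional.complete ℝ 𝔸
  have h0 : HasDerivAt (fun t : ℝ => NormedSpace.exp (t • X)) X 0 := by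
    simpa using hasDerivAt_exp_smul_const (𝕂 := ℝ) X 0
  have h2 := (LinearMap.toContinuousLinearMap L).hasFDerivAt.comp_hasDerivAt (0 : ℝ) h0
  have h3 : IsLocalMax (LinearMap.toContinuousLinearMap L ∘
      fun t : ℝ => NormedSpace.exp (t • X)) 0 := by
    refine Filter.Eventually.of_forall fun t => ?_
    simpa using h t
  simpa using h3.hasDerivAt_eq_zero h2

theorem trace_mul_eq_zero_of_exp_le {n : Type*} [Fintype n] [DecidableEq n] {M X : Matrix n n ℝ}
    (h : ∀ t : ℝ, (M * NormedSpace.exp (t • X)).trace ≤ M.trace) : (M * X).trace = 0 := by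
  let : NormedRing (Matrix n n ℝ) := Matrix.linftyOpNormedRing
  let : NormedAlgebra ℝ (Matrix n n ℝ) := Matrix.linftyOpNormedAlgebra
  let L : Matrix n n ℝ →ₗ[ℝ] ℝ := (Matrix.traceLinearMap n ℝ ℝ).comp (LinearMap.mulLeft ℝ M)
  refine linearMap_eq_zero_of_exp_le L X fun t => (h t).trans_eq ?_
  simp [L]

theorem isCompact_entrywise_bounded (m n : Type*) [Finite m] [Finite n] (r : ℝ) :
    IsCompact {M : Matrix m n ℝ | ∀ i j, |M i j| ≤ r} := by
  have h : IsCompact (Set.univ.pi fun _ : m => Set.univ.pi fun _ : n => Set.Icc (-r) r) :=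
    isCompact_univ_pi fun _ => isCompact_univ_pi fun _ => isCompact_Icc
  have h' : {M : Matrix m n ℝ | ∀ i j, |M i j| ≤ r} =
      Set.univ.pi fun _ : m => Set.univ.pi fun _ : n => Set.Icc (-r) r :=
    Set.ext fun M => ⟨fun h i _ j _ => abs_le.1 (h i j),
      fun h i j => abs_le.2 (h i trivial j trivial)⟩
  rw [h']
  exact h

theorem sq_entry_le_trace {m n : Type*} [Fintype m] [Fintype n] (M : Matrix m n ℝ) (i : m) (j : n) :
    M i j ^ 2 ≤ (Mᵀ * M).trace := by
  have h : (Mᵀ * M).trace = ∑ j, ∑ i, M i j ^ 2 := by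
    simp [Matrix.trace, Matrix.mul_apply, pow_two]
  rw [h]
  exact (Finset.single_le_sum (f := fun i => M i j ^ 2) (fun _ _ => sq_nonneg _)
    (Finset.mem_univ i)).trans (Finset.single_le_sum (f := fun j => ∑ i, M i j ^ 2)
      (fun _ _ => Finset.sum_nonneg fun _ _ => sq_nonneg _) (Finset.mem_univ j))

theorem abs_entry_le_one_add_trace {m n : Type*} [Fintype m] [Fintype n] (M : Matrix m n ℝ)
    (i : m) (j : n) : |M i j| ≤ 1 + (Mᵀ * M).trace := by
  have h := sq_entry_le_trace M i j
  rw [← sq_abs] at h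
  nlinarith [sq_nonneg (|M i j| - 1)]

theorem isCompact_orthogonal (n : Type*) [Fintype n] [DecidableEq n] :
    IsCompact {U : Matrix n n ℝ | Uᵀ * U = 1} := by
  refine (isCompact_entrywise_bounded n n (1 + (1 : Matrix n n ℝ).trace)).of_isClosed_subset
    (isClosed_eq (by fun_prop) continuous_const) fun U hU i j => ?_
  have := abs_entry_le_one_add_trace U i j
  rwa [show Uᵀ * U = 1 from hU] at this

/-- The Frobenius norm of `C * V` attains its minimum over the isometries `V` of a form `J`. -/
theorem exists_minimal_trace {n : Type*} [Fintype n] [DecidableEq n] {C : Matrix n n ℝ}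
    (hC : IsUnit C) (J : Matrix n n ℝ) :
    ∃ V : Matrix n n ℝ, Vᵀ * J * V = J ∧ ∀ W : Matrix n n ℝ, Wᵀ * J * W = J →
      ((C * V)ᵀ * (C * V)).trace ≤ ((C * W)ᵀ * (C * W)).trace := by
  have hdet : IsUnit C.det := (Matrix.isUnit_iff_isUnit_det C).1 hC
  let K : Set (Matrix n n ℝ) :=
    {V | Vᵀ * J * V = J ∧ ((C * V)ᵀ * (C * V)).trace ≤ (Cᵀ * C).trace}
  have hcont : Continuous fun V : Matrix n n ℝ => ((C * V)ᵀ * (C * V)).trace := by fun_prop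
  have hK : IsCompact K := by
    have hb := (isCompact_entrywise_bounded n n (1 + (Cᵀ * C).trace)).image
      (show Continuous fun Y : Matrix n n ℝ => C⁻¹ * Y by fun_prop)
    refine hb.of_isClosed_subset ((isClosed_eq (by fun_prop) continuous_const).inter
      (isClosed_le hcont continuous_const)) ?_
    rintro V ⟨-, hV⟩
    refine ⟨C * V, fun i j => (abs_entry_le_one_add_trace _ i j).trans (by linarith), ?_⟩
    exact Matrix.nonsing_inv_mul_cancel_left _ _ hdet
  have h1 : (1 : Matrix n n ℝ) ∈ K := by simp [K]
  obtain ⟨V, hV, hmin⟩ := hK.exists_isMinOn ⟨1, h1⟩ hcont.continuousOn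
  refine ⟨V, hV.1, fun W hW => ?_⟩
  by_cases hWK : ((C * W)ᵀ * (C * W)).trace ≤ (Cᵀ * C).trace
  · exact hmin ⟨hW, hWK⟩
  · exact hV.2.trans (not_le.1 hWK).le

theorem isUnit_signature (p q : Type*) [Fintype p] [Fintype q] [DecidableEq p] [DecidableEq q] :
    IsUnit (fromBlocks 1 0 0 (-1) : Matrix (p ⊕ q) (p ⊕ q) ℝ) := by
  refine IsUnit.of_mul_eq_one (fromBlocks 1 0 0 (-1)) ?_
  simp [fromBlocks_multiply]

/-- A positive definite matrix is congruent to a block diagonal one by an isometry of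
`diag(1, -1)`. -/
theorem exists_isometry_block_diagonal {p q : Type*} [Fintype p] [Fintype q] [DecidableEq p]
    [DecidableEq q] {C : Matrix (p ⊕ q) (p ⊕ q) ℝ} (hC : IsUnit C) :
    ∃ V : Matrix (p ⊕ q) (p ⊕ q) ℝ,
      Vᵀ * fromBlocks 1 0 0 (-1) * V = fromBlocks 1 0 0 (-1) ∧
      ∃ A B, Vᵀ * (Cᵀ * C) * V = fromBlocks A 0 0 B := by
  set J : Matrix (p ⊕ q) (p ⊕ q) ℝ := fromBlocks 1 0 0 (-1) with hJ
  obtain ⟨V, hV, hmin⟩ := exists_minimal_trace hC J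
  set M := Vᵀ * (Cᵀ * C) * V with hM
  have hMsymm : Mᵀ = M := by simp [hM, Matrix.mul_assoc]
  refine ⟨V, hV, M.toBlocks₁₁, M.toBlocks₂₂, ?_⟩
  set Z := M.toBlocks₁₂ with hZ
  have hZt : M.toBlocks₂₁ = Zᵀ := by
    conv_lhs => rw [← hMsymm]
    rfl
  have hMb : M = fromBlocks M.toBlocks₁₁ Z Zᵀ M.toBlocks₂₂ := by
    rw [← hZt, hZ, fromBlocks_toBlocks]
  let X : Matrix (p ⊕ q) (p ⊕ q) ℝ := fromBlocks 0 Z Zᵀ 0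
  have hXs : Xᵀ = X := by simp [X, fromBlocks_transpose]
  have key : ((-M) * ((2 : ℝ) • X)).trace = 0 := by
    refine trace_mul_eq_zero_of_exp_le fun t => ?_
    have hE : (NormedSpace.exp (t • X))ᵀ = NormedSpace.exp (t • X) := by
      rw [← Matrix.exp_transpose, transpose_smul, hXs]
    have hiso : (NormedSpace.exp (t • X))ᵀ * J * NormedSpace.exp (t • X) = J := by
      refine exp_preserves_form (isUnit_signature p q) ?_
      rw [transpose_smul, hXs]
      simp [X, hJ, fromBlocks_multiply, fromBlocks_neg, ← smul_neg]
    have h2 := hmin (V * NormedSpace.exp (t • X)) (by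
      calc _ = (NormedSpace.exp (t • X))ᵀ * (Vᵀ * J * V) * NormedSpace.exp (t • X) := by
            simp only [transpose_mul, Matrix.mul_assoc]
        _ = J := by rw [hV, hiso])
    have h3 : (C * V)ᵀ * (C * V) = M := by simp [hM, Matrix.mul_assoc]
    have h4 : ((C * (V * NormedSpace.exp (t • X)))ᵀ * (C * (V * NormedSpace.exp (t • X)))).trace
        = (M * NormedSpace.exp (t • (2 : ℝ) • X)).trace := by
      have h5 : NormedSpace.exp (t • (2 : ℝ) • X)
          = NormedSpace.exp (t • X) * NormedSpace.exp (t • X) := by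
        rw [← Matrix.exp_add_of_commute _ _ (Commute.refl _), ← two_smul ℝ, smul_comm]
      rw [h5, ← Matrix.mul_assoc M, trace_mul_comm (M * _), transpose_mul, transpose_mul, hE, hM]
      simp only [Matrix.mul_assoc]
    rw [h3, h4] at h2
    rw [Matrix.neg_mul, trace_neg, trace_neg]
    linarith
  have hZ0 : (Z * Zᵀ).trace = 0 := by
    rw [hMb] at key
    simp only [X, Matrix.mul_smul, Matrix.neg_mul, fromBlocks_multiply, trace_smul, trace_neg,
      Matrix.mul_zero, zero_add, add_zero] at key
    have h7 : (fromBlocks (Z * Zᵀ) (M.toBlocks₁₁ * Z) (M.toBlocks₂₂ * Zᵀ) (Zᵀ * Z)).trace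
        = (Z * Zᵀ).trace + (Zᵀ * Z).trace := by simp [Matrix.trace]
    rw [h7, trace_mul_comm Zᵀ Z] at key
    simp only [smul_eq_mul] at key
    linarith
  have hZ' : Z = 0 := by
    rw [← conjTranspose_eq_transpose_of_trivial] at hZ0
    exact trace_mul_conjTranspose_self_eq_zero_iff.1 hZ0
  calc M = _ := hMb
    _ = _ := by rw [hZ', transpose_zero]

theorem trace_mul_skew_eq_zero_imp_symm {n : Type*} [Fintype n] {A : Matrix n n ℝ}
    (h : ∀ X : Matrix n n ℝ, Xᵀ = -X → (A * X).trace = 0) : Aᵀ = A := by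
  have h1 := h (A - Aᵀ) (by simp)
  have h2 : ((A - Aᵀ) * (A - Aᵀ)ᵀ).trace = 0 := by
    have h3 : (Aᵀ * (A - Aᵀ)).trace = 0 := by
      have := h (A - Aᵀ) (by simp)
      rw [← trace_transpose, transpose_mul, transpose_sub, transpose_transpose, trace_mul_comm,
        ← neg_sub A Aᵀ, Matrix.mul_neg, trace_neg, this, neg_zero]
    rw [transpose_sub, transpose_transpose, ← neg_sub A Aᵀ, Matrix.mul_neg, trace_neg,
      Matrix.sub_mul, trace_sub, h1, h3]
    simp
  rw [← conjTranspose_eq_transpose_of_trivial (A - Aᵀ)] at h2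
  exact (sub_eq_zero.1 (trace_mul_conjTranspose_self_eq_zero_iff.1 h2)).symm

theorem orthogonal_mul_exp_skew {n : Type*} [Fintype n] [DecidableEq n] {U X : Matrix n n ℝ}
    (hU : Uᵀ * U = 1) (hX : Xᵀ = -X) (t : ℝ) :
    (U * NormedSpace.exp (t • X))ᵀ * (U * NormedSpace.exp (t • X)) = 1 := by
  have h := exp_preserves_form (J := (1 : Matrix n n ℝ)) (X := t • X) isUnit_one (by simp [hX])
  rw [Matrix.mul_one] at h
  rw [transpose_mul, Matrix.mul_assoc, ← Matrix.mul_assoc Uᵀ, hU, Matrix.one_mul, h]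

/-- For every weight `N` there are orthogonal `U`, `W` such that the products of `Uᵀ F W` with `N`
in both orders are symmetric. -/
theorem exists_orthogonal_symm_products {m n : Type*} [Fintype m] [Fintype n] [DecidableEq m]
    [DecidableEq n] (F : Matrix m n ℝ) (N : Matrix n m ℝ) :
    ∃ (U : Matrix m m ℝ) (W : Matrix n n ℝ), Uᵀ * U = 1 ∧ Wᵀ * W = 1 ∧
      (Uᵀ * F * W * N)ᵀ = Uᵀ * F * W * N ∧ (N * (Uᵀ * F * W))ᵀ = N * (Uᵀ * F * W) := by
  have hcont : Continuous fun x : Matrix m m ℝ × Matrix n n ℝ =>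
      (x.1ᵀ * F * x.2 * N).trace := by fun_prop
  obtain ⟨⟨U, W⟩, ⟨hU, hW⟩, hmax⟩ :=
    ((isCompact_orthogonal m).prod (isCompact_orthogonal n)).exists_isMaxOn
      ⟨(1, 1), by simp, by simp⟩ hcont.continuousOn
  refine ⟨U, W, hU, hW, trace_mul_skew_eq_zero_imp_symm fun X hX => ?_,
    trace_mul_skew_eq_zero_imp_symm fun X hX => ?_⟩
  · refine trace_mul_eq_zero_of_exp_le fun t => ?_
    have hE : (NormedSpace.exp (t • -X))ᵀ = NormedSpace.exp (t • X) := by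
      rw [← Matrix.exp_transpose, transpose_smul, transpose_neg, hX, neg_neg]
    have h := hmax (show (U * NormedSpace.exp (t • -X), W) ∈ _ from
      ⟨orthogonal_mul_exp_skew hU (by simp [hX]) t, hW⟩)
    refine le_of_eq_of_le ?_ h
    simp only [transpose_mul, hE]
    rw [trace_mul_comm]
    simp only [Matrix.mul_assoc]
  · refine trace_mul_eq_zero_of_exp_le fun t => ?_
    have h := hmax (show (U, W * NormedSpace.exp (t • X)) ∈ _ from
      ⟨hU, orthogonal_mul_exp_skew hW hX t⟩)
    rw [trace_mul_comm N]
    refine le_of_eq_of_le ?_ h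
    rw [Matrix.mul_assoc, trace_mul_comm]
    simp only [Matrix.mul_assoc]

theorem hyperbolicIndexEquiv_inl_castLE (a b : ℕ) (k : Fin (min a b)) :
    hyperbolicIndexEquiv a b (Sum.inl (k.castLE (min_le_left a b))) = Sum.inl (Sum.inl k) := by
  rw [← Equiv.eq_symm_apply]
  apply finSumFinEquiv.injective
  simp [hyperbolicIndexEquiv, Fin.ext_iff]

theorem hyperbolicIndexEquiv_inl_of_le (a b : ℕ) (x : Fin a) (hx : min a b ≤ x) :
    ∃ j, hyperbolicIndexEquiv a b (Sum.inl x) = Sum.inl (Sum.inr j) := by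
  refine ⟨⟨x - min a b, by omega⟩, ?_⟩
  rw [← Equiv.eq_symm_apply]
  apply finSumFinEquiv.injective
  simp [hyperbolicIndexEquiv, Fin.ext_iff]
  omega

theorem exists_hyperbolicIndexEquiv_inr (a b : ℕ) (k : Fin (min a b)) :
    ∃ y, hyperbolicIndexEquiv a b (Sum.inr y) = Sum.inr k := by
  refine ⟨⟨b - min a b + k, by omega⟩, ?_⟩
  rw [← Equiv.eq_symm_apply]
  apply finSumFinEquiv.injective
  simp [hyperbolicIndexEquiv, Fin.ext_iff]
  omega

theorem hyperbolicIndexEquiv_symm_middle (a b : ℕ) :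
    (∀ j, ∃ x, (hyperbolicIndexEquiv a b).symm (Sum.inl (Sum.inr j)) = Sum.inl x) ∨
      ∀ j, ∃ y, (hyperbolicIndexEquiv a b).symm (Sum.inl (Sum.inr j)) = Sum.inr y := by
  rcases le_total b a with h | h
  · refine Or.inl fun j => ⟨⟨min a b + j, by omega⟩, ?_⟩
    apply finSumFinEquiv.injective
    simp [hyperbolicIndexEquiv, Fin.ext_iff]
  · refine Or.inr fun j => ⟨⟨j, by omega⟩, ?_⟩
    apply finSumFinEquiv.injective
    simp [hyperbolicIndexEquiv, Fin.ext_iff, h]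

theorem exists_signature_eq_submatrix (a b : ℕ) :
    ∃ j : Matrix (Fin (max a b - min a b)) (Fin (max a b - min a b)) ℝ,
      (fromBlocks 1 0 0 (-1) : Matrix (Fin a ⊕ Fin b) (Fin a ⊕ Fin b) ℝ) =
        (fromBlocks (fromBlocks 1 0 0 j) 0 0 (-1)).submatrix
          (hyperbolicIndexEquiv a b) (hyperbolicIndexEquiv a b) := by
  have hl := fun k => (Equiv.eq_symm_apply _).2 (hyperbolicIndexEquiv_inl_castLE a b k)
  have hr := fun k => (exists_hyperbolicIndexEquiv_inr a b k).imp
    fun y hy => (Equiv.eq_symm_apply _).2 hy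
  choose c hc using hr
  set d : Fin a ⊕ Fin b → ℝ := Sum.elim 1 (-1) with hd
  have hJ : (fromBlocks 1 0 0 (-1) : Matrix (Fin a ⊕ Fin b) (Fin a ⊕ Fin b) ℝ) = diagonal d := by
    ext (i | i) (k | k) <;> simp [hd, Matrix.one_apply, diagonal_apply, apply_ite]
  refine ⟨diagonal fun j => d ((hyperbolicIndexEquiv a b).symm (Sum.inl (Sum.inr j))), ?_⟩
  have h1 : (-1 : Matrix (Fin (min a b)) (Fin (min a b)) ℝ) = diagonal fun _ => -1 := by
    rw [← diagonal_one, diagonal_neg]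
  rw [hJ, h1, ← diagonal_one, fromBlocks_diagonal, fromBlocks_diagonal,
    submatrix_diagonal_equiv, diagonal_eq_diagonal_iff]
  intro z
  obtain ⟨z, rfl⟩ := (hyperbolicIndexEquiv a b).symm.surjective z
  rcases z with (k | j) | k
  · simp [← hl, hd]
    simp [hl]
  · simp
  · simp [← hc, hd]
    simp [hc]

section blockRotation
variable {m n : ℕ}

theorem hyperbolicBlockRotation_mul (θ φ : Fin n → ℝ) :
    hyperbolicBlockRotation m n θ * hyperbolicBlockRotation m n φ =
      hyperbolicBlockRotation m n (θ + φ) := by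
  have h : ∀ i, Real.cosh (θ i + φ i) =
      Real.cosh (θ i) * Real.cosh (φ i) + Real.sinh (θ i) * Real.sinh (φ i) :=
    fun i => Real.cosh_add _ _
  have h' : ∀ i, Real.sinh (θ i + φ i) =
      Real.cosh (θ i) * Real.sinh (φ i) + Real.sinh (θ i) * Real.cosh (φ i) :=
    fun i => (Real.sinh_add _ _).trans (add_comm _ _)
  simp [hyperbolicBlockRotation, fromBlocks_multiply, fromRows_mul, mul_fromCols,
    fromCols_mul_fromRows, fromBlocks_mul_fromRows, fromCols_mul_fromBlocks, h, h']
  refine ⟨?_, ?_, ?_, fun i => add_comm _ _⟩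
  · ext (i | i) (k | k) <;> simp [diagonal_apply, ite_add_ite]
  · ext (i | i) k <;> simp [diagonal_apply, ite_add_ite]
  · ext i (k | k) <;> simp [diagonal_apply, ite_add_ite, add_comm]

theorem hyperbolicBlockRotation_transpose (θ : Fin n → ℝ) :
    (hyperbolicBlockRotation m n θ)ᵀ = hyperbolicBlockRotation m n θ := by
  simp [hyperbolicBlockRotation, fromBlocks_transpose, transpose_fromRows, transpose_fromCols]

theorem hyperbolicBlockRotation_form (θ : Fin n → ℝ) (j : Matrix (Fin (m - n)) (Fin (m - n)) ℝ) :
    hyperbolicBlockRotation m n θ * fromBlocks (fromBlocks 1 0 0 j) 0 0 (-1) *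
      hyperbolicBlockRotation m n θ = fromBlocks (fromBlocks 1 0 0 j) 0 0 (-1) := by
  simp [hyperbolicBlockRotation, fromBlocks_multiply, fromRows_mul, mul_fromCols,
    fromCols_mul_fromRows, fromBlocks_mul_fromRows,
    fromCols_mul_fromBlocks]
  have h : ∀ i, Real.cosh (θ i) * Real.cosh (θ i) = 1 + Real.sinh (θ i) * Real.sinh (θ i) :=
    fun i => by nlinarith [Real.cosh_sq (θ i)]
  refine ⟨?_, ?_, ?_, ?_⟩
  · ext (i | i) (k | k) <;> simp [diagonal_apply, Matrix.one_apply, ite_add_ite, h]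
  · ext (i | i) k <;> simp [diagonal_apply, ite_add_ite, mul_comm]
  · ext i (k | k) <;> simp [diagonal_apply, ite_add_ite, mul_comm]
  · ext i k
    simp [diagonal_apply, Matrix.one_apply, h, apply_ite]

/-- A pair of matrices acting on the two hyperbolic index blocks, and trivially on the middle. -/
def blockConjugator (m : ℕ) (s t : Matrix (Fin n) (Fin n) ℝ) :
    Matrix ((Fin n ⊕ Fin (m - n)) ⊕ Fin n) ((Fin n ⊕ Fin (m - n)) ⊕ Fin n) ℝ :=
  fromBlocks (fromBlocks s 0 0 1) 0 0 t

theorem blockConjugator_form {s t : Matrix (Fin n) (Fin n) ℝ} (hs : sᵀ * s = 1) (ht : tᵀ * t = 1)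
    (j : Matrix (Fin (m - n)) (Fin (m - n)) ℝ) (c : ℝ) :
    (blockConjugator m s t)ᵀ * fromBlocks (fromBlocks 1 0 0 j) 0 0 (c • 1) * blockConjugator m s t
      = fromBlocks (fromBlocks 1 0 0 j) 0 0 (c • 1) := by
  simp [blockConjugator, fromBlocks_multiply, fromBlocks_transpose, hs, ht]

theorem blockConjugator_conj (θ θ' : Fin n → ℝ) {s t : Matrix (Fin n) (Fin n) ℝ}
    (h₁ : sᵀ * (diagonal fun i => Real.cosh (θ i)) * s = diagonal fun i => Real.cosh (θ' i))
    (h₂ : tᵀ * (diagonal fun i => Real.cosh (θ i)) * t = diagonal fun i => Real.cosh (θ' i))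
    (h₃ : sᵀ * (diagonal fun i => Real.sinh (θ i)) * t = diagonal fun i => Real.sinh (θ' i)) :
    (blockConjugator m s t)ᵀ * hyperbolicBlockRotation m n θ * blockConjugator m s t =
      hyperbolicBlockRotation m n θ' := by
  have h₄ : tᵀ * (diagonal fun i => Real.sinh (θ i)) * s = diagonal fun i => Real.sinh (θ' i) := by
    rw [← transpose_inj]
    simpa [Matrix.mul_assoc] using h₃
  simp [blockConjugator, hyperbolicBlockRotation, fromBlocks_multiply, fromBlocks_transpose,
    fromBlocks_mul_fromRows, fromRows_mul, fromCols_mul_fromBlocks, mul_fromCols, h₁, h₂, h₃, h₄]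

theorem exists_blockConjugator {θ θ' : Fin n → ℝ} (h : EqUpToPermSign θ θ') :
    ∃ s t : Matrix (Fin n) (Fin n) ℝ, sᵀ * s = 1 ∧ tᵀ * t = 1 ∧
      (blockConjugator m s t)ᵀ * hyperbolicBlockRotation m n θ * blockConjugator m s t =
        hyperbolicBlockRotation m n θ' := by
  obtain ⟨σ, ε, h⟩ := h
  set P : Matrix (Fin n) (Fin n) ℝ := (1 : Matrix (Fin n) (Fin n) ℝ).submatrix id σ with hP
  set E : Matrix (Fin n) (Fin n) ℝ := diagonal fun i => ((ε i : ℤ) : ℝ) with hE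
  have hPd : ∀ d : Fin n → ℝ, Pᵀ * diagonal d * P = diagonal fun i => d (σ i) := by
    intro d
    ext i j
    by_cases hij : i = j
    · simp [hP, Matrix.mul_apply, Matrix.one_apply, diagonal_apply, hij]
    · simp [hP, Matrix.mul_apply, Matrix.one_apply, diagonal_apply, hij]
  have hPP : Pᵀ * P = 1 := by
    have := hPd 1
    rw [show (diagonal 1 : Matrix (Fin n) (Fin n) ℝ) = 1 from diagonal_one] at this
    simpa using this
  have hε : ∀ i, ((ε i : ℤ) : ℝ) = 1 ∨ ((ε i : ℤ) : ℝ) = -1 := fun i => by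
    rcases Int.units_eq_one_or (ε i) with h | h <;> simp [h]
  have hEd : ∀ d : Fin n → ℝ, E * diagonal d * E = diagonal d := by
    intro d
    rw [hE, diagonal_mul_diagonal, diagonal_mul_diagonal, diagonal_eq_diagonal_iff]
    intro i
    rcases hε i with h | h <;> simp [h]
  have hEt : Eᵀ = E := by simp [hE]
  have hcosh : ∀ i, Real.cosh (θ' i) = Real.cosh (θ (σ i)) := fun i => by
    rcases hε i with h' | h' <;> simp [h, h']
  have hsinh : ∀ i, Real.sinh (θ' i) = ((ε i : ℤ) : ℝ) * Real.sinh (θ (σ i)) := fun i => by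
    rcases hε i with h' | h' <;> simp [h, h']
  refine ⟨P * E, P, ?_, hPP, blockConjugator_conj θ θ' ?_ ?_ ?_⟩
  · rw [transpose_mul, hEt, Matrix.mul_assoc, ← Matrix.mul_assoc Pᵀ, hPP]
    have := hEd 1
    rw [show (diagonal 1 : Matrix (Fin n) (Fin n) ℝ) = 1 from diagonal_one] at this
    simpa using this
  · simp only [hcosh]
    rw [← hEd fun i => Real.cosh (θ (σ i)), ← hPd fun i => Real.cosh (θ i), transpose_mul, hEt]
    simp only [Matrix.mul_assoc]
  · simp only [hcosh]
    rw [← hPd fun i => Real.cosh (θ i)]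
  · simp only [hsinh]
    rw [← diagonal_mul_diagonal, ← hE, ← hPd fun i => Real.sinh (θ i), transpose_mul, hEt]
    simp only [Matrix.mul_assoc]

end blockRotation

/-- An isometry of `diag(1, -1)` that is orthogonal is block diagonal with orthogonal blocks. -/
theorem eq_fromBlocks_of_orthogonal_of_isometry {p q : Type*} [Fintype p] [Fintype q]
    [DecidableEq p] [DecidableEq q] {K : Matrix (p ⊕ q) (p ⊕ q) ℝ} (hK : Kᵀ * K = 1)
    (hJ : Kᵀ * fromBlocks 1 0 0 (-1) * K = fromBlocks 1 0 0 (-1)) :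
    ∃ U W, Uᵀ * U = 1 ∧ Wᵀ * W = 1 ∧ K = fromBlocks U 0 0 W := by
  have hK' : K * Kᵀ = 1 := mul_eq_one_comm.1 hK
  have hcomm : fromBlocks 1 0 0 (-1) * K = K * fromBlocks 1 0 0 (-1) := by
    rw [← hJ, ← Matrix.mul_assoc, ← Matrix.mul_assoc, hK', Matrix.one_mul, hJ]
  rw [← fromBlocks_toBlocks K] at hcomm hK ⊢
  simp only [fromBlocks_multiply, Matrix.one_mul, Matrix.mul_one, Matrix.zero_mul, Matrix.mul_zero,
    add_zero, zero_add, Matrix.neg_mul, Matrix.mul_neg, fromBlocks_inj] at hcomm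
  have h12 : K.toBlocks₁₂ = 0 := by
    ext i j
    exact self_eq_neg.1 (congrFun (congrFun hcomm.2.1 i) j)
  have h21 : K.toBlocks₂₁ = 0 := by
    ext i j
    exact neg_eq_self.1 (congrFun (congrFun hcomm.2.2.1 i) j)
  rw [h12, h21] at hK ⊢
  rw [fromBlocks_transpose, fromBlocks_multiply, ← fromBlocks_one, fromBlocks_inj] at hK
  exact ⟨_, _, by simpa using hK.1, by simpa using hK.2.2.2, rfl⟩

section hyperbolicH
variable {a b : ℕ}

theorem hyperbolicH_mul (θ φ : Fin (min a b) → ℝ) :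
    hyperbolicH a b θ * hyperbolicH a b φ = hyperbolicH a b (θ + φ) := by
  rw [hyperbolicH, hyperbolicH, submatrix_mul_equiv, hyperbolicBlockRotation_mul, hyperbolicH]

theorem hyperbolicH_transpose (θ : Fin (min a b) → ℝ) :
    (hyperbolicH a b θ)ᵀ = hyperbolicH a b θ := by
  rw [hyperbolicH, transpose_submatrix, hyperbolicBlockRotation_transpose]

theorem hyperbolicH_zero : hyperbolicH a b 0 = 1 := by
  have h : hyperbolicBlockRotation (max a b) (min a b) 0 = 1 := by
    simp [hyperbolicBlockRotation, ← Pi.one_def]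
  rw [hyperbolicH, h, submatrix_one_equiv]

theorem hyperbolicH_form (θ : Fin (min a b) → ℝ) :
    hyperbolicH a b θ * fromBlocks 1 0 0 (-1) * hyperbolicH a b θ = fromBlocks 1 0 0 (-1) := by
  obtain ⟨j, hj⟩ := exists_signature_eq_submatrix a b
  rw [hj, hyperbolicH, submatrix_mul_equiv, submatrix_mul_equiv, hyperbolicBlockRotation_form]

theorem exists_hyperbolicH_conj {θ θ' : Fin (min a b) → ℝ} (h : EqUpToPermSign θ θ') :
    ∃ U W, Uᵀ * U = 1 ∧ Wᵀ * W = 1 ∧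
      (fromBlocks U 0 0 W)ᵀ * hyperbolicH a b θ * fromBlocks U 0 0 W = hyperbolicH a b θ' := by
  obtain ⟨j, hj⟩ := exists_signature_eq_submatrix a b
  obtain ⟨s, t, hs, ht, h⟩ := exists_blockConjugator (m := max a b) h
  set K := (blockConjugator (max a b) s t).submatrix
    (hyperbolicIndexEquiv a b) (hyperbolicIndexEquiv a b) with hK
  obtain ⟨U, W, hU, hW, hUW⟩ := eq_fromBlocks_of_orthogonal_of_isometry (K := K)
    (by
      have := blockConjugator_form (m := max a b) hs ht 1 1
      simp only [one_smul, fromBlocks_one, Matrix.mul_one] at this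
      rw [hK, transpose_submatrix, submatrix_mul_equiv, this, submatrix_one_equiv])
    (by
      have := blockConjugator_form (m := max a b) hs ht j (-1)
      simp only [neg_smul, one_smul] at this
      rw [hj, hK, transpose_submatrix, submatrix_mul_equiv, submatrix_mul_equiv, this])
  refine ⟨U, W, hU, hW, ?_⟩
  rw [← hUW, hK, hyperbolicH, transpose_submatrix, submatrix_mul_equiv, submatrix_mul_equiv, h,
    hyperbolicH]

/-- The diagonal entries of the hyperbolic block rotation. -/
noncomputable def hyperbolicDiag {m n : ℕ} (θ : Fin n → ℝ) : (Fin n ⊕ Fin (m - n)) ⊕ Fin n → ℝ :=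
  Sum.elim (Sum.elim (fun i => Real.cosh (θ i)) 1) fun i => Real.cosh (θ i)

theorem one_le_hyperbolicDiag {m n : ℕ} (θ : Fin n → ℝ) (z : (Fin n ⊕ Fin (m - n)) ⊕ Fin n) :
    1 ≤ hyperbolicDiag θ z := by
  rcases z with (i | i) | i <;> simp [hyperbolicDiag, Real.one_le_cosh]

theorem hyperbolicBlockRotation_apply {m n : ℕ} (θ : Fin n → ℝ)
    {z z' : (Fin n ⊕ Fin (m - n)) ⊕ Fin n}
    (h : ∀ k, z = Sum.inl (Sum.inl k) → z' ≠ Sum.inr k)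
    (h' : ∀ k, z' = Sum.inl (Sum.inl k) → z ≠ Sum.inr k) :
    hyperbolicBlockRotation m n θ z z' = diagonal (hyperbolicDiag θ) z z' := by
  rcases z with (i | i) | i <;> rcases z' with (k | k) | k <;>
    simp_all [hyperbolicBlockRotation, hyperbolicDiag, diagonal_apply, Matrix.one_apply, eq_comm]

theorem hyperbolicIndexEquiv_inl_ne (x : Fin a) (k : Fin (min a b)) :
    hyperbolicIndexEquiv a b (Sum.inl x) ≠ Sum.inr k := by
  obtain ⟨y, hy⟩ := exists_hyperbolicIndexEquiv_inr a b k
  rw [← hy]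
  simp

theorem hyperbolicIndexEquiv_inr_ne (y : Fin b) (k : Fin (min a b)) :
    hyperbolicIndexEquiv a b (Sum.inr y) ≠ Sum.inl (Sum.inl k) := by
  rw [← hyperbolicIndexEquiv_inl_castLE]
  simp

theorem hyperbolicH_toBlocks₁₁ (θ : Fin (min a b) → ℝ) :
    (hyperbolicH a b θ).toBlocks₁₁ =
      diagonal fun x => hyperbolicDiag θ (hyperbolicIndexEquiv a b (Sum.inl x)) := by
  ext x x'
  rw [toBlocks₁₁, of_apply, hyperbolicH, submatrix_apply, hyperbolicBlockRotation_apply]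
  · simp [diagonal_apply]
  · exact fun k _ => hyperbolicIndexEquiv_inl_ne _ _
  · exact fun k _ => hyperbolicIndexEquiv_inl_ne _ _

theorem hyperbolicH_toBlocks₂₂ (θ : Fin (min a b) → ℝ) :
    (hyperbolicH a b θ).toBlocks₂₂ =
      diagonal fun x => hyperbolicDiag θ (hyperbolicIndexEquiv a b (Sum.inr x)) := by
  ext x x'
  rw [toBlocks₂₂, of_apply, hyperbolicH, submatrix_apply, hyperbolicBlockRotation_apply]
  · simp [diagonal_apply]
  · exact fun k h => absurd h (hyperbolicIndexEquiv_inr_ne _ _)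
  · exact fun k h => absurd h (hyperbolicIndexEquiv_inr_ne _ _)

theorem hyperbolicH_eq_fromBlocks (θ : Fin (min a b) → ℝ) :
    hyperbolicH a b θ = fromBlocks
      (diagonal fun x => hyperbolicDiag θ (hyperbolicIndexEquiv a b (Sum.inl x)))
      (hyperbolicH a b θ).toBlocks₁₂ (hyperbolicH a b θ).toBlocks₁₂ᵀ
      (diagonal fun x => hyperbolicDiag θ (hyperbolicIndexEquiv a b (Sum.inr x))) := by
  have h : (hyperbolicH a b θ).toBlocks₂₁ = (hyperbolicH a b θ).toBlocks₁₂ᵀ := by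
    conv_lhs => rw [← hyperbolicH_transpose]
    rfl
  rw [← h, ← hyperbolicH_toBlocks₁₁, ← hyperbolicH_toBlocks₂₂, fromBlocks_toBlocks]

theorem hyperbolicH_block_relations (θ : Fin (min a b) → ℝ) :
    (hyperbolicH a b θ).toBlocks₁₁ * (hyperbolicH a b θ).toBlocks₁₁ =
        1 + (hyperbolicH a b θ).toBlocks₁₂ * (hyperbolicH a b θ).toBlocks₁₂ᵀ ∧
      (hyperbolicH a b θ).toBlocks₂₂ * (hyperbolicH a b θ).toBlocks₂₂ =
        1 + (hyperbolicH a b θ).toBlocks₁₂ᵀ * (hyperbolicH a b θ).toBlocks₁₂ := by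
  have h := hyperbolicH_form θ
  rw [hyperbolicH_eq_fromBlocks, ← hyperbolicH_toBlocks₁₁, ← hyperbolicH_toBlocks₂₂] at h
  simp only [fromBlocks_multiply, Matrix.mul_one, Matrix.mul_zero, add_zero, zero_add,
    Matrix.neg_mul, Matrix.mul_neg, fromBlocks_inj] at h
  constructor
  · rw [← h.1]
    abel
  · rw [← neg_inj, neg_add, ← h.2.2.2]
    abel

theorem prod_hyperbolicDiag (θ : Fin (min a b) → ℝ) {M : Type*} [CommMonoid M] (f : ℝ → M) :
    ∏ x : Fin a, f (hyperbolicDiag θ (hyperbolicIndexEquiv a b (Sum.inl x))) =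
      (∏ k, f (Real.cosh (θ k))) * f 1 ^ (a - min a b) := by
  let e : Fin (min a b) ⊕ Fin (a - min a b) ≃ Fin a :=
    finSumFinEquiv.trans (finCongr (by omega))
  rw [← e.prod_comp, Fintype.prod_sum_type]
  congr 1
  · refine Finset.prod_congr rfl fun k _ => ?_
    rw [show e (Sum.inl k) = k.castLE (min_le_left a b) from rfl, hyperbolicIndexEquiv_inl_castLE]
    rfl
  · have h : ∀ k, f (hyperbolicDiag θ (hyperbolicIndexEquiv a b (Sum.inl (e (Sum.inr k))))) = f 1 := by
      intro k
      obtain ⟨j, hj⟩ := hyperbolicIndexEquiv_inl_of_le a b (e (Sum.inr k)) (by simp [e])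
      rw [hj]
      rfl
    simp [h]

/-- Singular value decomposition, with the diagonal pattern of the off-diagonal block of
`hyperbolicH`. -/
theorem exists_orthogonal_eq_toBlocks₁₂ (F : Matrix (Fin a) (Fin b) ℝ) :
    ∃ (U : Matrix (Fin a) (Fin a) ℝ) (W : Matrix (Fin b) (Fin b) ℝ), Uᵀ * U = 1 ∧ Wᵀ * W = 1 ∧
      ∃ θ : Fin (min a b) → ℝ, Uᵀ * F * W = (hyperbolicH a b θ).toBlocks₁₂ := by
  let φ : Fin (min a b) → ℝ := fun k => k + 1
  set N := (hyperbolicH a b φ).toBlocks₁₂ with hN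
  set e := hyperbolicIndexEquiv a b with he
  obtain ⟨U, W, hU, hW, h1, h2⟩ := exists_orthogonal_symm_products F Nᵀ
  set M := Uᵀ * F * W with hM
  refine ⟨U, W, hU, hW, ?_⟩
  have hrel := hyperbolicH_block_relations φ
  rw [hyperbolicH_toBlocks₁₁, hyperbolicH_toBlocks₂₂, ← hN, diagonal_mul_diagonal,
    diagonal_mul_diagonal, ← he] at hrel
  have h2' : Mᵀ * N = Nᵀ * M := by simpa using h2
  have hMN : M * (Nᵀ * N) = N * Nᵀ * M := by
    rw [← Matrix.mul_assoc, ← h1, transpose_mul, transpose_transpose, Matrix.mul_assoc N,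
      Matrix.mul_assoc N, h2']
  have hent : ∀ x y, M x y * (hyperbolicDiag φ (e (Sum.inr y)) * hyperbolicDiag φ (e (Sum.inr y)))
      = hyperbolicDiag φ (e (Sum.inl x)) * hyperbolicDiag φ (e (Sum.inl x)) * M x y := by
    intro x y
    have h : M * (1 + Nᵀ * N) = (1 + N * Nᵀ) * M := by
      rw [Matrix.mul_add, Matrix.add_mul, hMN, Matrix.mul_one, Matrix.one_mul]
    rw [← hrel.1, ← hrel.2] at h
    simpa using congrFun (congrFun h x) y
  have hcosh : ∀ k k', Real.cosh (φ k) = Real.cosh (φ k') → k = k' := by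
    intro k k' h
    have h' := Real.cosh_injOn (show φ k ∈ Set.Ici 0 from by simp [φ]; positivity)
      (show φ k' ∈ Set.Ici 0 from by simp [φ]; positivity) h
    simpa [φ, Fin.ext_iff] using h'
  have hcosh1 : ∀ k, 1 < Real.cosh (φ k) := fun k =>
    Real.one_lt_cosh.2 (show (k : ℝ) + 1 ≠ 0 by positivity)
  have hzero : ∀ x y, M x y ≠ 0 → ∃ k, e (Sum.inl x) = Sum.inl (Sum.inl k) ∧
      e (Sum.inr y) = Sum.inr k := by
    intro x y hxy
    have h3 : hyperbolicDiag φ (e (Sum.inl x)) = hyperbolicDiag φ (e (Sum.inr y)) := by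
      have h := hent x y
      rw [mul_comm, mul_left_inj' hxy] at h
      nlinarith [one_le_hyperbolicDiag φ (e (Sum.inl x)), one_le_hyperbolicDiag φ (e (Sum.inr y))]
    rcases hx : e (Sum.inl x) with (k | j) | k
    · rcases hy : e (Sum.inr y) with (k' | j') | k'
      · exact absurd hy (hyperbolicIndexEquiv_inr_ne _ _)
      · rw [hx, hy] at h3
        exact absurd h3 (hcosh1 k).ne'
      · rw [hx, hy] at h3
        exact ⟨k, rfl, by rw [hcosh k k' h3]⟩
    · rcases hy : e (Sum.inr y) with (k' | j') | k'
      · exact absurd hy (hyperbolicIndexEquiv_inr_ne _ _)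
      · rw [← Equiv.eq_symm_apply] at hx hy
        rcases hyperbolicIndexEquiv_symm_middle a b with h | h
        · obtain ⟨x', hx'⟩ := h j'
          rw [← he, ← hy] at hx'
          exact absurd hx' (by simp)
        · obtain ⟨y', hy'⟩ := h j
          rw [← he, ← hx] at hy'
          exact absurd hy' (by simp)
      · rw [hx, hy] at h3
        exact absurd h3 (hcosh1 k').ne
    · exact absurd hx (hyperbolicIndexEquiv_inl_ne _ _)
  choose c hc using exists_hyperbolicIndexEquiv_inr a b
  refine ⟨fun k => Real.arsinh (M (k.castLE (min_le_left a b)) (c k)), ?_⟩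
  ext x y
  rw [toBlocks₁₂, of_apply, hyperbolicH, submatrix_apply, ← he]
  change M x y = _
  by_cases hk : ∃ k, e (Sum.inl x) = Sum.inl (Sum.inl k) ∧ e (Sum.inr y) = Sum.inr k
  · obtain ⟨k, hx, hy⟩ := hk
    have hx' : x = k.castLE (min_le_left a b) := Sum.inl_injective
      (e.injective (hx.trans (hyperbolicIndexEquiv_inl_castLE a b k).symm))
    have hy' : y = c k := Sum.inr_injective (e.injective (hy.trans (hc k).symm))
    rw [hx, hy, hx', hy']
    simp [hyperbolicBlockRotation, Real.sinh_arsinh]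
  · rw [not_imp_comm.1 (hzero x y) hk, hyperbolicBlockRotation_apply]
    · simp
    · exact fun k hx hy => hk ⟨k, hx, hy⟩
    · exact fun k hy => absurd hy (hyperbolicIndexEquiv_inr_ne _ _)

end hyperbolicH

open scoped MatrixOrder Matrix.Norms.L2Operator in
theorem posDef_exists_isUnit_transpose_mul_self {n : Type*} [Fintype n] [DecidableEq n]
    {A : Matrix n n ℝ} (hA : A.PosDef) : ∃ C : Matrix n n ℝ, IsUnit C ∧ A = Cᵀ * C := by
  obtain ⟨C, hC, h⟩ := CStarAlgebra.isStrictlyPositive_iff_eq_star_mul_self.mp hA.isStrictlyPositive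
  exact ⟨C, hC, by rwa [star_eq_conjTranspose, conjTranspose_eq_transpose_of_trivial] at h⟩

theorem posDef_transpose_mul_mul {n : Type*} [Fintype n] [DecidableEq n]
    {A : Matrix n n ℝ} (hA : A.PosDef) {U : Matrix n n ℝ} (hU : IsUnit U) : (Uᵀ * A * U).PosDef := by
  rw [← conjTranspose_eq_transpose_of_trivial]
  exact hA.conjTranspose_mul_mul_same (mulVec_injective_of_isUnit hU)

/-- The Sylvester equation `A X + X D = 0` with positive definite coefficients. -/
theorem eq_zero_of_posDef_sylvester {m n : Type*} [Fintype m] [Fintype n] [DecidableEq m]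
    {A : Matrix m m ℝ} {D : Matrix n n ℝ} {X : Matrix m n ℝ} (hA : A.PosDef) (hD : D.PosDef)
    (h : A * X + X * D = 0) : X = 0 := by
  have h1 : 0 ≤ (X * D * Xᵀ).trace := by
    have := (hD.posSemidef.mul_mul_conjTranspose_same X).trace_nonneg
    rwa [conjTranspose_eq_transpose_of_trivial] at this
  obtain ⟨C, hC, rfl⟩ := posDef_exists_isUnit_transpose_mul_self hA
  have h2 : (Xᵀ * (Cᵀ * C * X + X * D)).trace = 0 := by rw [h]; simp
  have h3 : 0 ≤ ((C * X)ᴴ * (C * X)).trace := (posSemidef_conjTranspose_mul_self (C * X)).trace_nonneg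
  have h4 : ((C * X)ᴴ * (C * X)).trace = 0 := by
    rw [Matrix.mul_add, trace_add, trace_mul_comm Xᵀ (X * D)] at h2
    have h5 : (C * X)ᴴ * (C * X) = Xᵀ * (Cᵀ * C * X) := by
      simp [conjTranspose_eq_transpose_of_trivial, Matrix.mul_assoc]
    rw [h5] at h3 ⊢
    linarith
  have h5 := trace_conjTranspose_mul_self_eq_zero_iff.1 h4
  have hdet : IsUnit C.det := (Matrix.isUnit_iff_isUnit_det C).1 hC
  rw [← Matrix.nonsing_inv_mul_cancel_left C X hdet, h5, Matrix.mul_zero]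

theorem eq_of_posDef_of_mul_self_eq {m : Type*} [Fintype m] [DecidableEq m]
    {A B : Matrix m m ℝ} (hA : A.PosDef) (hB : B.PosDef) (h : A * A = B * B) : A = B := by
  refine sub_eq_zero.1 (eq_zero_of_posDef_sylvester hA hB ?_)
  rw [Matrix.mul_sub, Matrix.sub_mul, h]
  abel

theorem isUnit_of_form_isometry {n : Type*} [Fintype n] [DecidableEq n] {J G : Matrix n n ℝ}
    (hJ : IsUnit J) (h : Gᵀ * J * G = J) : IsUnit G :=
  isUnit_of_mul_isUnit_right (h ▸ hJ)

theorem form_isometry_mul {n : Type*} [Fintype n] {J G K : Matrix n n ℝ}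
    (hG : Gᵀ * J * G = J) (hK : Kᵀ * J * K = J) : (G * K)ᵀ * J * (G * K) = J := by
  calc _ = Kᵀ * (Gᵀ * J * G) * K := by simp only [transpose_mul, Matrix.mul_assoc]
    _ = J := by rw [hG, hK]

theorem form_isometry_inv {n : Type*} [Fintype n] [DecidableEq n] {J G : Matrix n n ℝ}
    (hJ : IsUnit J) (h : Gᵀ * J * G = J) : (G⁻¹)ᵀ * J * G⁻¹ = J := by
  have hd := (Matrix.isUnit_iff_isUnit_det G).1 (isUnit_of_form_isometry hJ h)
  calc (G⁻¹)ᵀ * J * G⁻¹ = (G⁻¹)ᵀ * (Gᵀ * J * G) * G⁻¹ := by rw [h]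
    _ = (G * G⁻¹)ᵀ * J * (G * G⁻¹) := by simp only [transpose_mul, Matrix.mul_assoc]
    _ = J := by simp [Matrix.mul_nonsing_inv G hd]

theorem form_isometry_transpose {n : Type*} [Fintype n] [DecidableEq n] {J G : Matrix n n ℝ}
    (hJ : J * J = 1) (h : Gᵀ * J * G = J) : Gᵀᵀ * J * Gᵀ = J := by
  have h1 : J * Gᵀ * J * G = 1 := by
    rw [Matrix.mul_assoc J, Matrix.mul_assoc J, h, hJ]
  have h2 : G * (J * Gᵀ * J) = 1 := mul_eq_one_comm.1 h1
  calc Gᵀᵀ * J * Gᵀ = G * (J * Gᵀ * J) * J := by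
        rw [transpose_transpose, ← Matrix.mul_assoc, ← Matrix.mul_assoc, Matrix.mul_assoc _ J J, hJ,
          Matrix.mul_one]
    _ = J := by rw [h2, Matrix.one_mul]

theorem hyperbolicH_posDef {a b : ℕ} (θ : Fin (min a b) → ℝ) : (hyperbolicH a b θ).PosDef := by
  set φ : Fin (min a b) → ℝ := (2⁻¹ : ℝ) • θ with hφ
  have h : hyperbolicH a b θ = (hyperbolicH a b φ)ᵀ * 1 * hyperbolicH a b φ := by
    rw [hyperbolicH_transpose, Matrix.mul_one, hyperbolicH_mul, hφ, ← add_smul]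
    norm_num
  have hu : IsUnit (hyperbolicH a b φ) := by
    refine IsUnit.of_mul_eq_one (hyperbolicH a b (-φ)) ?_
    rw [hyperbolicH_mul, add_neg_cancel, hyperbolicH_zero]
  rw [h]
  exact posDef_transpose_mul_mul PosDef.one hu

/-- A positive definite isometry of `diag(1, -1)` is conjugate, under block orthogonal matrices, to
a hyperbolic block rotation. -/
theorem exists_conj_eq_hyperbolicH {a b : ℕ} {A : Matrix (Fin a) (Fin a) ℝ}
    {F : Matrix (Fin a) (Fin b) ℝ} {D : Matrix (Fin b) (Fin b) ℝ} (hA : A.PosDef) (hD : D.PosDef)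
    (hAF : A * A = 1 + F * Fᵀ) (hDF : D * D = 1 + Fᵀ * F) :
    ∃ (U : Matrix (Fin a) (Fin a) ℝ) (W : Matrix (Fin b) (Fin b) ℝ), Uᵀ * U = 1 ∧ Wᵀ * W = 1 ∧
      ∃ θ : Fin (min a b) → ℝ,
      (fromBlocks U 0 0 W)ᵀ * fromBlocks A F Fᵀ D * fromBlocks U 0 0 W = hyperbolicH a b θ := by
  obtain ⟨U, W, hU, hW, θ, hθ⟩ := exists_orthogonal_eq_toBlocks₁₂ F
  have hU' : U * Uᵀ = 1 := mul_eq_one_comm.1 hU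
  have hW' : W * Wᵀ = 1 := mul_eq_one_comm.1 hW
  refine ⟨U, W, hU, hW, θ, ?_⟩
  obtain ⟨h1, h2⟩ := hyperbolicH_block_relations θ
  have hpd := hyperbolicH_posDef θ
  have e1 : Uᵀ * A * U = (hyperbolicH a b θ).toBlocks₁₁ := by
    refine eq_of_posDef_of_mul_self_eq (posDef_transpose_mul_mul hA (IsUnit.of_mul_eq_one _ hU'))
      (hpd.submatrix Sum.inl_injective) ?_
    rw [h1, ← hθ]
    calc Uᵀ * A * U * (Uᵀ * A * U) = Uᵀ * A * (U * Uᵀ) * A * U := by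
          simp only [Matrix.mul_assoc]
      _ = Uᵀ * (A * A) * U := by rw [hU', Matrix.mul_one]; simp only [Matrix.mul_assoc]
      _ = Uᵀ * U + Uᵀ * F * (W * Wᵀ) * Fᵀ * U := by
          rw [hAF, hW', Matrix.mul_add, Matrix.add_mul, Matrix.mul_one, Matrix.mul_one]
          simp only [Matrix.mul_assoc]
      _ = _ := by rw [hU]; simp only [transpose_mul, transpose_transpose, Matrix.mul_assoc]
  have e2 : Wᵀ * D * W = (hyperbolicH a b θ).toBlocks₂₂ := by
    refine eq_of_posDef_of_mul_self_eq (posDef_transpose_mul_mul hD (IsUnit.of_mul_eq_one _ hW'))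
      (hpd.submatrix Sum.inr_injective) ?_
    rw [h2, ← hθ]
    calc Wᵀ * D * W * (Wᵀ * D * W) = Wᵀ * D * (W * Wᵀ) * D * W := by
          simp only [Matrix.mul_assoc]
      _ = Wᵀ * (D * D) * W := by rw [hW', Matrix.mul_one]; simp only [Matrix.mul_assoc]
      _ = Wᵀ * W + Wᵀ * Fᵀ * (U * Uᵀ) * F * W := by
          rw [hDF, hU', Matrix.mul_add, Matrix.add_mul, Matrix.mul_one, Matrix.mul_one]
          simp only [Matrix.mul_assoc]
      _ = _ := by rw [hW]; simp only [transpose_mul, transpose_transpose, Matrix.mul_assoc]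
  rw [hyperbolicH_eq_fromBlocks, ← hyperbolicH_toBlocks₁₁, ← hyperbolicH_toBlocks₂₂, ← hθ, ← e1,
    ← e2]
  simp [fromBlocks_multiply, fromBlocks_transpose, Matrix.mul_assoc]

/-- The regrouping of the four index blocks from `(p₁, q₁), (p₂, q₂)` to `(p₁, q₂), (p₂, q₁)`. -/
def regroupEquiv (p₁ q₁ p₂ q₂ : Type*) : (p₁ ⊕ q₁) ⊕ (p₂ ⊕ q₂) ≃ (p₁ ⊕ q₂) ⊕ (p₂ ⊕ q₁) where
  toFun := Sum.elim (Sum.elim (Sum.inl ∘ Sum.inl) (Sum.inr ∘ Sum.inr))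
    (Sum.elim (Sum.inr ∘ Sum.inl) (Sum.inl ∘ Sum.inr))
  invFun := Sum.elim (Sum.elim (Sum.inl ∘ Sum.inl) (Sum.inr ∘ Sum.inr))
    (Sum.elim (Sum.inr ∘ Sum.inl) (Sum.inl ∘ Sum.inr))
  left_inv := by rintro ((_ | _) | (_ | _)) <;> rfl
  right_inv := by rintro ((_ | _) | (_ | _)) <;> rfl

section regroup
variable {p₁ q₁ p₂ q₂ : Type*}

theorem submatrix_regroupEquiv (A : Matrix p₁ p₁ ℝ) (F : Matrix p₁ q₂ ℝ) (F' : Matrix q₂ p₁ ℝ)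
    (D : Matrix q₂ q₂ ℝ) (B : Matrix p₂ p₂ ℝ) (G : Matrix p₂ q₁ ℝ) (G' : Matrix q₁ p₂ ℝ)
    (E : Matrix q₁ q₁ ℝ) :
    (fromBlocks (fromBlocks A F F' D) 0 0 (fromBlocks B G G' E)).submatrix
        (regroupEquiv p₁ q₁ p₂ q₂) (regroupEquiv p₁ q₁ p₂ q₂) =
      fromBlocks (fromBlocks A 0 0 E) (fromBlocks 0 F G' 0)
        (fromBlocks 0 G F' 0) (fromBlocks B 0 0 D) := by
  ext ((_ | _) | (_ | _)) ((_ | _) | (_ | _)) <;> rfl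

variable [Fintype p₁] [Fintype q₁] [Fintype p₂] [Fintype q₂]
  [DecidableEq p₁] [DecidableEq q₁] [DecidableEq p₂] [DecidableEq q₂]

/-- The two-block signature `diag(1, -1, 1, -1)`. -/
def doubleSignature (p₁ q₁ p₂ q₂ : Type*) [DecidableEq p₁] [DecidableEq q₁] [DecidableEq p₂]
    [DecidableEq q₂] : Matrix ((p₁ ⊕ q₁) ⊕ (p₂ ⊕ q₂)) ((p₁ ⊕ q₁) ⊕ (p₂ ⊕ q₂)) ℝ :=
  fromBlocks (fromBlocks 1 0 0 (-1)) 0 0 (fromBlocks 1 0 0 (-1))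

theorem doubleSignature_mul_self :
    doubleSignature p₁ q₁ p₂ q₂ * doubleSignature p₁ q₁ p₂ q₂ = 1 := by
  simp [doubleSignature, fromBlocks_multiply]

/-- A positive definite isometry of the signature that is block diagonal inside each group only
couples `p₁` with `q₂` and `p₂` with `q₁`. -/
theorem posDef_isometry_regroup {M : Matrix ((p₁ ⊕ q₁) ⊕ (p₂ ⊕ q₂)) ((p₁ ⊕ q₁) ⊕ (p₂ ⊕ q₂)) ℝ}
    (hM : M.PosDef) (hJ : Mᵀ * doubleSignature p₁ q₁ p₂ q₂ * M = doubleSignature p₁ q₁ p₂ q₂)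
    {A₁ : Matrix p₁ p₁ ℝ} {B₁ : Matrix q₁ q₁ ℝ} {A₂ : Matrix p₂ p₂ ℝ} {B₂ : Matrix q₂ q₂ ℝ}
    (h₁ : M.toBlocks₁₁ = fromBlocks A₁ 0 0 B₁) (h₂ : M.toBlocks₂₂ = fromBlocks A₂ 0 0 B₂) :
    A₁.PosDef ∧ B₁.PosDef ∧ A₂.PosDef ∧ B₂.PosDef ∧ ∃ (F : Matrix p₁ q₂ ℝ) (G : Matrix p₂ q₁ ℝ),
      A₁ * A₁ = 1 + F * Fᵀ ∧ B₂ * B₂ = 1 + Fᵀ * F ∧ A₂ * A₂ = 1 + G * Gᵀ ∧ B₁ * B₁ = 1 + Gᵀ * G ∧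
      M = (fromBlocks (fromBlocks A₁ F Fᵀ B₂) 0 0 (fromBlocks A₂ G Gᵀ B₁)).submatrix
        (regroupEquiv p₁ q₁ p₂ q₂) (regroupEquiv p₁ q₁ p₂ q₂) := by
  have hMt : Mᵀ = M := by simpa using hM.isHermitian.eq
  have d1 : (fromBlocks A₁ 0 0 B₁).PosDef := h₁ ▸ hM.submatrix Sum.inl_injective
  have d2 : (fromBlocks A₂ 0 0 B₂).PosDef := h₂ ▸ hM.submatrix Sum.inr_injective
  have hA₁ : A₁.PosDef := d1.submatrix Sum.inl_injective
  have hB₁ : B₁.PosDef := d1.submatrix Sum.inr_injective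
  have hA₂ : A₂.PosDef := d2.submatrix Sum.inl_injective
  have hB₂ : B₂.PosDef := d2.submatrix Sum.inr_injective
  refine ⟨hA₁, hB₁, hA₂, hB₂, ?_⟩
  set N := M.toBlocks₁₂ with hN
  have h21 : M.toBlocks₂₁ = Nᵀ := by
    conv_lhs => rw [← hMt]
    rfl
  have hMb : M = fromBlocks (fromBlocks A₁ 0 0 B₁) N Nᵀ (fromBlocks A₂ 0 0 B₂) := by
    rw [← h₁, ← h₂, ← h21, hN, fromBlocks_toBlocks]
  rw [← fromBlocks_toBlocks N] at hMb
  rw [hMt, hMb, doubleSignature, fromBlocks_transpose] at hJ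
  simp only [fromBlocks_multiply, fromBlocks_add, fromBlocks_inj, Matrix.mul_one, Matrix.mul_zero,
    add_zero, zero_add, Matrix.neg_mul, Matrix.mul_neg, Matrix.zero_mul,
    neg_zero] at hJ
  obtain ⟨⟨h11, -, -, h44⟩, hoff, -, h22, -, -, h33⟩ := hJ
  rw [← fromBlocks_zero, fromBlocks_inj] at hoff
  have hE : N.toBlocks₁₁ = 0 := eq_zero_of_posDef_sylvester hA₁ hA₂ hoff.1
  have hK : N.toBlocks₂₂ = 0 := by
    refine eq_zero_of_posDef_sylvester hB₁ hB₂ ?_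
    rw [← neg_eq_zero, neg_add]
    exact hoff.2.2.2
  simp only [hE, hK, transpose_zero, Matrix.mul_zero, neg_zero, add_zero,
    zero_add] at h11 h44 h22 h33 hMb
  refine ⟨N.toBlocks₁₂, N.toBlocks₂₁ᵀ, ?_, ?_, ?_, ?_, ?_⟩
  · rw [← h11]; abel
  · rw [← neg_inj, neg_add, ← h33]; abel
  · rw [← h22, transpose_transpose]; abel
  · rw [← neg_inj, neg_add, ← h44, transpose_transpose]; abel
  · rw [submatrix_regroupEquiv, hMb, fromBlocks_transpose, transpose_transpose, transpose_zero,
      transpose_zero]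
end regroup

section factorization
variable {p₁ p₂ q₁ q₂ : ℕ}

/-- The index bijection underlying the permutation matrix `permP₁`. -/
def permEquiv (p₁ p₂ q₁ q₂ : ℕ) :
    Fin (p₁ + p₂) ⊕ Fin (q₁ + q₂) ≃ (Fin p₁ ⊕ Fin q₁) ⊕ (Fin p₂ ⊕ Fin q₂) :=
  (Equiv.sumCongr finSumFinEquiv.symm finSumFinEquiv.symm).trans
    (Equiv.sumSumSumComm (Fin p₁) (Fin p₂) (Fin q₁) (Fin q₂))

theorem permP₁_eq : permP₁ p₁ p₂ q₁ q₂ =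
    (1 : Matrix ((Fin p₁ ⊕ Fin q₁) ⊕ (Fin p₂ ⊕ Fin q₂)) _ ℝ).submatrix id
      (permEquiv p₁ p₂ q₁ q₂) := by
  ext i j
  rcases j with j | j <;> obtain ⟨j, rfl⟩ := finSumFinEquiv.surjective j <;>
  rcases i with (i | i) | (i | i) <;> rcases j with j | j <;>
  simp [permP₁, permEquiv, Matrix.one_apply, -finSumFinEquiv_apply_left,
    -finSumFinEquiv_apply_right]

theorem permP₂_eq : permP₂ p₁ p₂ q₁ q₂ =
    (1 : Matrix ((Fin p₁ ⊕ Fin q₂) ⊕ (Fin p₂ ⊕ Fin q₁)) _ ℝ).submatrix id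
      ((permEquiv p₁ p₂ q₁ q₂).trans (regroupEquiv _ _ _ _)) := by
  ext i j
  rcases j with j | j <;> obtain ⟨j, rfl⟩ := finSumFinEquiv.surjective j <;>
  rcases i with (i | i) | (i | i) <;> rcases j with j | j <;>
  simp [permP₂, permEquiv, regroupEquiv, Matrix.one_apply, -finSumFinEquiv_apply_left,
    -finSumFinEquiv_apply_right]

theorem one_submatrix_conj {m n : Type*} [Fintype m] [DecidableEq m] (e : n ≃ m)
    (X : Matrix m m ℝ) :
    ((1 : Matrix m m ℝ).submatrix id e)ᵀ * X * (1 : Matrix m m ℝ).submatrix id e =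
      X.submatrix e e := by
  ext i j
  simp [Matrix.mul_apply, Matrix.one_apply]

theorem form_isometry_submatrix_symm {m n : Type*} [Fintype m] [Fintype n] (e : n ≃ m)
    {D : Matrix m m ℝ} {Q : Matrix n n ℝ}
    (h : Qᵀ * D.submatrix e e * Q = D.submatrix e e) :
    (Q.submatrix e.symm e.symm)ᵀ * D * Q.submatrix e.symm e.symm = D := by
  have := congrArg (fun M => M.submatrix e.symm e.symm) h
  simpa [← submatrix_mul_equiv _ _ _ e.symm] using this

theorem doubleSignature_submatrix :
    (doubleSignature (Fin p₁) (Fin q₁) (Fin p₂) (Fin q₂)).submatrix (permEquiv p₁ p₂ q₁ q₂)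
      (permEquiv p₁ p₂ q₁ q₂) = fromBlocks 1 0 0 (-1) := by
  ext i j
  rcases i with i | i <;> obtain ⟨i, rfl⟩ := finSumFinEquiv.surjective i <;>
  rcases j with j | j <;> obtain ⟨j, rfl⟩ := finSumFinEquiv.surjective j <;>
  rcases i with i | i <;> rcases j with j | j <;>
  simp [doubleSignature, permEquiv, Matrix.one_apply, -finSumFinEquiv_apply_left,
    -finSumFinEquiv_apply_right]

/-- The middle factor of the factorization, in the index order `p₁, q₁, p₂, q₂`. -/
noncomputable def doubleH (θ : Fin (min p₁ q₂) → ℝ) (γ : Fin (min p₂ q₁) → ℝ) :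
    Matrix ((Fin p₁ ⊕ Fin q₁) ⊕ (Fin p₂ ⊕ Fin q₂)) ((Fin p₁ ⊕ Fin q₁) ⊕ (Fin p₂ ⊕ Fin q₂)) ℝ :=
  (fromBlocks (hyperbolicH p₁ q₂ θ) 0 0 (hyperbolicH p₂ q₁ γ)).submatrix
    (regroupEquiv _ _ _ _) (regroupEquiv _ _ _ _)

theorem doubleH_mul (θ θ' : Fin (min p₁ q₂) → ℝ) (γ γ' : Fin (min p₂ q₁) → ℝ) :
    doubleH θ γ * doubleH θ' γ' = doubleH (θ + θ') (γ + γ') := by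
  simp [doubleH, submatrix_mul_equiv, fromBlocks_multiply, hyperbolicH_mul]

theorem doubleH_transpose (θ : Fin (min p₁ q₂) → ℝ) (γ : Fin (min p₂ q₁) → ℝ) :
    (doubleH θ γ)ᵀ = doubleH θ γ := by
  simp [doubleH, transpose_submatrix, fromBlocks_transpose, hyperbolicH_transpose]

theorem doubleSignature_eq_regroup :
    doubleSignature (Fin p₁) (Fin q₁) (Fin p₂) (Fin q₂) =
      (fromBlocks (fromBlocks 1 0 0 (-1)) 0 0 (fromBlocks 1 0 0 (-1))).submatrix
        (regroupEquiv _ _ _ _) (regroupEquiv _ _ _ _) := by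
  rw [submatrix_regroupEquiv, doubleSignature, fromBlocks_zero, fromBlocks_zero]

theorem doubleH_form (θ : Fin (min p₁ q₂) → ℝ) (γ : Fin (min p₂ q₁) → ℝ) :
    (doubleH θ γ)ᵀ * doubleSignature _ _ _ _ * doubleH θ γ = doubleSignature _ _ _ _ := by
  rw [doubleH_transpose, doubleSignature_eq_regroup, doubleH, submatrix_mul_equiv,
    submatrix_mul_equiv, fromBlocks_multiply]
  simp [fromBlocks_multiply, hyperbolicH_form]

theorem isUnit_doubleSignature (p₁ q₁ p₂ q₂ : Type*) [Fintype p₁] [Fintype q₁] [Fintype p₂]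
    [Fintype q₂] [DecidableEq p₁] [DecidableEq q₁] [DecidableEq p₂] [DecidableEq q₂] :
    IsUnit (doubleSignature p₁ q₁ p₂ q₂) :=
  IsUnit.of_mul_eq_one _ doubleSignature_mul_self

theorem doubleSignature_isometry_of_mem {V₁ : Matrix (Fin p₁ ⊕ Fin q₁) (Fin p₁ ⊕ Fin q₁) ℝ}
    {V₂ : Matrix (Fin p₂ ⊕ Fin q₂) (Fin p₂ ⊕ Fin q₂) ℝ} (h₁ : V₁ ∈ indefiniteOrthogonal p₁ q₁)
    (h₂ : V₂ ∈ indefiniteOrthogonal p₂ q₂) :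
    (fromBlocks V₁ 0 0 V₂)ᵀ * doubleSignature _ _ _ _ * fromBlocks V₁ 0 0 V₂ =
      doubleSignature _ _ _ _ := by
  rw [indefiniteOrthogonal, Set.mem_ofPred_eq] at h₁ h₂
  rw [doubleSignature, fromBlocks_transpose]
  simp only [fromBlocks_multiply (n := Fin p₁ ⊕ Fin q₁), transpose_zero, Matrix.mul_zero,
    Matrix.zero_mul, add_zero, zero_add, h₁, h₂]

/-- The Gram matrix `OᵀO` in the index order `p₁, q₁, p₂, q₂`. -/
def regroupedGram (O : Matrix (Fin (p₁ + p₂) ⊕ Fin (q₁ + q₂)) (Fin (p₁ + p₂) ⊕ Fin (q₁ + q₂)) ℝ) :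
    Matrix ((Fin p₁ ⊕ Fin q₁) ⊕ (Fin p₂ ⊕ Fin q₂)) ((Fin p₁ ⊕ Fin q₁) ⊕ (Fin p₂ ⊕ Fin q₂)) ℝ :=
  (Oᵀ * O).submatrix (permEquiv p₁ p₂ q₁ q₂).symm (permEquiv p₁ p₂ q₁ q₂).symm

theorem hasFactorization_iff_gram
    {O : Matrix (Fin (p₁ + p₂) ⊕ Fin (q₁ + q₂)) (Fin (p₁ + p₂) ⊕ Fin (q₁ + q₂)) ℝ}
    (hO : O ∈ indefiniteOrthogonal (p₁ + p₂) (q₁ + q₂))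
    (θ : Fin (min p₁ q₂) → ℝ) (γ : Fin (min p₂ q₁) → ℝ) :
    HasFactorization O θ γ ↔
      ∃ V₁ ∈ indefiniteOrthogonal p₁ q₁, ∃ V₂ ∈ indefiniteOrthogonal p₂ q₂,
        regroupedGram O = (fromBlocks V₁ 0 0 V₂)ᵀ * doubleH (θ + θ) (γ + γ) * fromBlocks V₁ 0 0 V₂ := by
  have key : ∀ V : Matrix ((Fin p₁ ⊕ Fin q₁) ⊕ (Fin p₂ ⊕ Fin q₂)) _ ℝ,
      ((permP₂ p₁ p₂ q₁ q₂)ᵀ * fromBlocks (hyperbolicH p₁ q₂ θ) 0 0 (hyperbolicH p₂ q₁ γ) *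
        permP₂ p₁ p₂ q₁ q₂) * ((permP₁ p₁ p₂ q₁ q₂)ᵀ * V * permP₁ p₁ p₂ q₁ q₂) =
      (doubleH θ γ * V).submatrix (permEquiv p₁ p₂ q₁ q₂) (permEquiv p₁ p₂ q₁ q₂) := by
    intro V
    rw [permP₁_eq, permP₂_eq, one_submatrix_conj, one_submatrix_conj,
      ← submatrix_mul_equiv _ _ _ (permEquiv p₁ p₂ q₁ q₂)]
    rfl
  set e := permEquiv p₁ p₂ q₁ q₂ with he
  have hgram : ∀ (K : Matrix (Fin (p₁ + p₂) ⊕ Fin (q₁ + q₂)) _ ℝ) (V : Matrix _ _ ℝ), Kᵀ * K = 1 →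
      regroupedGram (K * (doubleH θ γ * V).submatrix e e) = Vᵀ * doubleH (θ + θ) (γ + γ) * V := by
    intro K V hK
    have h : (K * (doubleH θ γ * V).submatrix e e)ᵀ * (K * (doubleH θ γ * V).submatrix e e) =
        (Vᵀ * doubleH (θ + θ) (γ + γ) * V).submatrix e e := by
      rw [transpose_mul, Matrix.mul_assoc, ← Matrix.mul_assoc Kᵀ, hK, Matrix.one_mul,
        transpose_submatrix, submatrix_mul_equiv, transpose_mul, doubleH_transpose, ← doubleH_mul]
      simp only [Matrix.mul_assoc]
    rw [regroupedGram, h, ← he]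
    simp
  constructor
  · rintro ⟨Op, hOp, Oq, hOq, V₁, h₁, V₂, h₂, h⟩
    refine ⟨V₁, h₁, V₂, h₂, ?_⟩
    rw [Matrix.mul_assoc, key] at h
    rw [h]
    refine hgram _ _ ?_
    rw [mem_orthogonalGroup_iff'] at hOp hOq
    simp [fromBlocks_transpose, fromBlocks_multiply, hOp, hOq]
  · rintro ⟨V₁, h₁, V₂, h₂, h⟩
    set V := fromBlocks V₁ 0 0 V₂ with hV
    have hVJ := doubleSignature_isometry_of_mem h₁ h₂
    have hHJ := doubleH_form θ γ
    have hJu := isUnit_doubleSignature (Fin p₁) (Fin q₁) (Fin p₂) (Fin q₂)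
    have hYJ := form_isometry_mul hHJ hVJ
    set Y := doubleH θ γ * V with hY
    have hYd := (Matrix.isUnit_iff_isUnit_det _).1 (isUnit_of_form_isometry hJu hYJ)
    set O' := O.submatrix e.symm e.symm with hO'
    have hOO : O = O'.submatrix e e := by simp [hO']
    have hO'J : O'ᵀ * doubleSignature _ _ _ _ * O' = doubleSignature _ _ _ _ := by
      rw [indefiniteOrthogonal, Set.mem_ofPred_eq, ← doubleSignature_submatrix, ← he] at hO
      exact form_isometry_submatrix_symm e hO
    have hO'g : O'ᵀ * O' = Yᵀ * Y := by
      have h3 : O'ᵀ * O' = regroupedGram O := by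
        rw [hO', transpose_submatrix, submatrix_mul_equiv, regroupedGram]
      rw [h3, h, hY, transpose_mul, doubleH_transpose, ← doubleH_mul]
      simp only [Matrix.mul_assoc]
    set K' := O' * Y⁻¹ with hK'
    have hK'o : K'ᵀ * K' = 1 := by
      calc K'ᵀ * K' = (Y⁻¹)ᵀ * (O'ᵀ * O') * Y⁻¹ := by
            rw [hK', transpose_mul]
            simp only [Matrix.mul_assoc]
        _ = (Y * Y⁻¹)ᵀ * (Y * Y⁻¹) := by
            rw [hO'g, transpose_mul Y]
            simp only [Matrix.mul_assoc]
        _ = 1 := by simp [Matrix.mul_nonsing_inv _ hYd]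
    have hK'J := form_isometry_mul hO'J (form_isometry_inv hJu hYJ)
    rw [← hK'] at hK'J
    have hO'K : O' = K' * Y := by
      rw [hK', Matrix.mul_assoc, Matrix.nonsing_inv_mul _ hYd, Matrix.mul_one]
    obtain ⟨U, W, hU, hW, hUW⟩ := eq_fromBlocks_of_orthogonal_of_isometry (K := K'.submatrix e e)
      (by rw [transpose_submatrix, submatrix_mul_equiv, hK'o, submatrix_one_equiv])
      (by rw [← doubleSignature_submatrix, transpose_submatrix, submatrix_mul_equiv,
            submatrix_mul_equiv, hK'J])
    refine ⟨U, ?_, W, ?_, V₁, h₁, V₂, h₂, ?_⟩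
    · rwa [mem_orthogonalGroup_iff']
    · rwa [mem_orthogonalGroup_iff']
    · rw [Matrix.mul_assoc, key, ← hUW, ← hV, ← hY, submatrix_mul_equiv, ← hO'K, hOO]

end factorization

section factorization
variable {p₁ p₂ q₁ q₂ : ℕ}

theorem EqUpToPermSign.symm {k : ℕ} {θ θ' : Fin k → ℝ} (h : EqUpToPermSign θ θ') :
    EqUpToPermSign θ' θ := by
  obtain ⟨σ, ε, h⟩ := h
  refine ⟨σ.symm, fun i => ε (σ.symm i), fun i => ?_⟩
  rw [h, ← mul_assoc, σ.apply_symm_apply]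
  rcases Int.units_eq_one_or (ε (σ.symm i)) with h | h <;> simp [h]

theorem EqUpToPermSign.add_self {k : ℕ} {θ θ' : Fin k → ℝ} (h : EqUpToPermSign θ θ') :
    EqUpToPermSign (θ + θ) (θ' + θ') := by
  obtain ⟨σ, ε, h⟩ := h
  exact ⟨σ, ε, fun i => by simp only [Pi.add_apply, h]; ring⟩

theorem fromBlocks_mem_indefiniteOrthogonal {p q : ℕ} {U : Matrix (Fin p) (Fin p) ℝ}
    {W : Matrix (Fin q) (Fin q) ℝ} (hU : Uᵀ * U = 1) (hW : Wᵀ * W = 1) :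
    fromBlocks U 0 0 W ∈ indefiniteOrthogonal p q := by
  simp [indefiniteOrthogonal, fromBlocks_transpose, fromBlocks_multiply, hU, hW]

theorem indefiniteOrthogonal_mul_mem {p q : ℕ} {G K : Matrix (Fin p ⊕ Fin q) (Fin p ⊕ Fin q) ℝ}
    (hG : G ∈ indefiniteOrthogonal p q) (hK : K ∈ indefiniteOrthogonal p q) :
    G * K ∈ indefiniteOrthogonal p q :=
  form_isometry_mul hG hK

theorem indefiniteOrthogonal_inv_mem {p q : ℕ} {G : Matrix (Fin p ⊕ Fin q) (Fin p ⊕ Fin q) ℝ}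
    (hG : G ∈ indefiniteOrthogonal p q) : G⁻¹ ∈ indefiniteOrthogonal p q :=
  form_isometry_inv (isUnit_signature _ _) hG

theorem regroup_fromBlocks (U₁ : Matrix (Fin p₁) (Fin p₁) ℝ) (W₂ : Matrix (Fin q₂) (Fin q₂) ℝ)
    (U₂ : Matrix (Fin p₂) (Fin p₂) ℝ) (W₁ : Matrix (Fin q₁) (Fin q₁) ℝ) :
    (fromBlocks (fromBlocks U₁ 0 0 W₂) 0 0 (fromBlocks U₂ 0 0 W₁)).submatrix
      (regroupEquiv _ _ _ _) (regroupEquiv _ _ _ _) =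
    fromBlocks (fromBlocks U₁ 0 0 W₁) 0 0 (fromBlocks U₂ 0 0 W₂) := by
  rw [submatrix_regroupEquiv, fromBlocks_zero, fromBlocks_zero]

theorem regroup_conj {a b c d : Type*} [Fintype a] [Fintype b] [Fintype c] [Fintype d]
    (K M : Matrix (a ⊕ d) (a ⊕ d) ℝ) (L N : Matrix (c ⊕ b) (c ⊕ b) ℝ) :
    ((fromBlocks K 0 0 L).submatrix (regroupEquiv a b c d) (regroupEquiv a b c d))ᵀ *
      (fromBlocks M 0 0 N).submatrix (regroupEquiv a b c d) (regroupEquiv a b c d) *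
      (fromBlocks K 0 0 L).submatrix (regroupEquiv a b c d) (regroupEquiv a b c d) =
    (fromBlocks (Kᵀ * M * K) 0 0 (Lᵀ * N * L)).submatrix
      (regroupEquiv a b c d) (regroupEquiv a b c d) := by
  rw [transpose_submatrix, submatrix_mul_equiv, submatrix_mul_equiv, fromBlocks_transpose]
  simp only [fromBlocks_multiply (n := a ⊕ d), transpose_zero, Matrix.mul_zero, Matrix.zero_mul,
    add_zero, zero_add]

theorem fromBlocks_diag_mul {m n : Type*} [Fintype m] [Fintype n] (A B : Matrix m m ℝ)
    (C D : Matrix n n ℝ) :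
    fromBlocks A 0 0 C * fromBlocks B 0 0 D = fromBlocks (A * B) 0 0 (C * D) := by
  simp [fromBlocks_multiply]

theorem hasFactorization_of_eqUpToPermSign
    {O : Matrix (Fin (p₁ + p₂) ⊕ Fin (q₁ + q₂)) (Fin (p₁ + p₂) ⊕ Fin (q₁ + q₂)) ℝ}
    (hO : O ∈ indefiniteOrthogonal (p₁ + p₂) (q₁ + q₂))
    {θ θ' : Fin (min p₁ q₂) → ℝ} {γ γ' : Fin (min p₂ q₁) → ℝ} (h : HasFactorization O θ γ)
    (hθ : EqUpToPermSign θ θ') (hγ : EqUpToPermSign γ γ') : HasFactorization O θ' γ' := by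
  rw [hasFactorization_iff_gram hO] at h ⊢
  obtain ⟨V₁, h₁, V₂, h₂, h⟩ := h
  obtain ⟨U₁, W₂, hU₁, hW₂, e₁⟩ := exists_hyperbolicH_conj hθ.symm.add_self
  obtain ⟨U₂, W₁, hU₂, hW₁, e₂⟩ := exists_hyperbolicH_conj hγ.symm.add_self
  refine ⟨_, indefiniteOrthogonal_mul_mem (fromBlocks_mem_indefiniteOrthogonal hU₁ hW₁) h₁,
    _, indefiniteOrthogonal_mul_mem (fromBlocks_mem_indefiniteOrthogonal hU₂ hW₂) h₂, ?_⟩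
  rw [h, ← fromBlocks_diag_mul, ← regroup_fromBlocks, doubleH, doubleH, ← e₁, ← e₂,
    ← regroup_conj]
  simp only [transpose_mul, Matrix.mul_assoc]

theorem exists_hasFactorization
    {O : Matrix (Fin (p₁ + p₂) ⊕ Fin (q₁ + q₂)) (Fin (p₁ + p₂) ⊕ Fin (q₁ + q₂)) ℝ}
    (hO : O ∈ indefiniteOrthogonal (p₁ + p₂) (q₁ + q₂)) :
    ∃ (θ : Fin (min p₁ q₂) → ℝ) (γ : Fin (min p₂ q₁) → ℝ), HasFactorization O θ γ := by
  set D := doubleSignature (Fin p₁) (Fin q₁) (Fin p₂) (Fin q₂) with hD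
  have hDu : IsUnit D := isUnit_doubleSignature _ _ _ _
  have hJu := isUnit_signature (Fin (p₁ + p₂)) (Fin (q₁ + q₂))
  have hOu : IsUnit O := isUnit_of_form_isometry hJu hO
  set S := regroupedGram O with hS
  have hSpd : S.PosDef := by
    have h := posDef_transpose_mul_mul PosDef.one hOu
    rw [Matrix.mul_one] at h
    exact h.submatrix (Equiv.injective _)
  have hSJ : Sᵀ * D * S = D := by
    have h := form_isometry_mul (form_isometry_transpose (by simp [fromBlocks_multiply]) hO) hO
    rw [← doubleSignature_submatrix] at h
    exact form_isometry_submatrix_symm _ h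
  obtain ⟨C₁, hC₁, hS₁⟩ := posDef_exists_isUnit_transpose_mul_self
    (show S.toBlocks₁₁.PosDef from hSpd.submatrix Sum.inl_injective)
  obtain ⟨C₂, hC₂, hS₂⟩ := posDef_exists_isUnit_transpose_mul_self
    (show S.toBlocks₂₂.PosDef from hSpd.submatrix Sum.inr_injective)
  obtain ⟨V₁, hV₁, A₁, B₁, e₁⟩ := exists_isometry_block_diagonal hC₁
  obtain ⟨V₂, hV₂, A₂, B₂, e₂⟩ := exists_isometry_block_diagonal hC₂
  rw [← hS₁] at e₁
  rw [← hS₂] at e₂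
  set Z := fromBlocks V₁ 0 0 V₂ with hZ
  have hZJ : Zᵀ * D * Z = D := doubleSignature_isometry_of_mem hV₁ hV₂
  have hZu : IsUnit Z := isUnit_of_form_isometry hDu hZJ
  have hMpd : (Zᵀ * S * Z).PosDef := posDef_transpose_mul_mul hSpd hZu
  have hMJ := form_isometry_mul (form_isometry_mul (form_isometry_transpose
    doubleSignature_mul_self hZJ) hSJ) hZJ
  have hMb : Zᵀ * S * Z = fromBlocks (V₁ᵀ * S.toBlocks₁₁ * V₁) (V₁ᵀ * S.toBlocks₁₂ * V₂)
      (V₂ᵀ * S.toBlocks₂₁ * V₁) (V₂ᵀ * S.toBlocks₂₂ * V₂) := by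
    conv_lhs => rw [← fromBlocks_toBlocks S]
    rw [hZ, fromBlocks_transpose]
    simp only [fromBlocks_multiply (n := Fin p₁ ⊕ Fin q₁), transpose_zero, Matrix.mul_zero,
      Matrix.zero_mul, add_zero, zero_add]
  obtain ⟨hA₁, hB₁, hA₂, hB₂, F, G, r₁, r₂, r₃, r₄, hM⟩ := posDef_isometry_regroup hMpd hMJ
    (by rw [hMb, toBlocks_fromBlocks₁₁, e₁]) (by rw [hMb, toBlocks_fromBlocks₂₂, e₂])
  obtain ⟨U₁, W₂, hU₁, hW₂, θ, hθ⟩ := exists_conj_eq_hyperbolicH hA₁ hB₂ r₁ r₂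
  obtain ⟨U₂, W₁, hU₂, hW₁, γ, hγ⟩ := exists_conj_eq_hyperbolicH hA₂ hB₁ r₃ r₄
  refine ⟨(2⁻¹ : ℝ) • θ, (2⁻¹ : ℝ) • γ, (hasFactorization_iff_gram hO _ _).2 ?_⟩
  have hV₁' := indefiniteOrthogonal_mul_mem hV₁ (fromBlocks_mem_indefiniteOrthogonal hU₁ hW₁)
  have hV₂' := indefiniteOrthogonal_mul_mem hV₂ (fromBlocks_mem_indefiniteOrthogonal hU₂ hW₂)
  have hi₁ := indefiniteOrthogonal_inv_mem hV₁'
  have hi₂ := indefiniteOrthogonal_inv_mem hV₂'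
  refine ⟨_, hi₁, _, hi₂, ?_⟩
  have hθ2 : (2⁻¹ : ℝ) • θ + (2⁻¹ : ℝ) • θ = θ := by rw [← add_smul]; norm_num
  have hγ2 : (2⁻¹ : ℝ) • γ + (2⁻¹ : ℝ) • γ = γ := by rw [← add_smul]; norm_num
  rw [hθ2, hγ2, doubleH, ← hθ, ← hγ, ← regroup_conj, ← hM, regroup_fromBlocks]
  set Y := fromBlocks (fromBlocks U₁ 0 0 W₁) 0 0 (fromBlocks U₂ 0 0 W₂) with hY
  set X := fromBlocks (V₁ * fromBlocks U₁ 0 0 W₁)⁻¹ 0 0 (V₂ * fromBlocks U₂ 0 0 W₂)⁻¹ with hX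
  have hd₁ := (Matrix.isUnit_iff_isUnit_det _).1
    (isUnit_of_form_isometry (isUnit_signature _ _) hV₁')
  have hd₂ := (Matrix.isUnit_iff_isUnit_det _).1
    (isUnit_of_form_isometry (isUnit_signature _ _) hV₂')
  have hZYX : Z * Y * X = 1 := by
    rw [hZ, hY, hX, fromBlocks_diag_mul, fromBlocks_diag_mul, Matrix.mul_nonsing_inv _ hd₁,
      Matrix.mul_nonsing_inv _ hd₂, fromBlocks_one]
  calc S = (Z * Y * X)ᵀ * S * (Z * Y * X) := by simp [hZYX]
    _ = _ := by simp only [transpose_mul, Matrix.mul_assoc]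

theorem exists_perm_of_map_eq {ι α : Type*} [Fintype ι] [DecidableEq α] {f g : ι → α}
    (h : Finset.univ.val.map f = Finset.univ.val.map g) : ∃ σ : Equiv.Perm ι, ∀ i, f i = g (σ i) := by
  have hc : ∀ y, Fintype.card {i // f i = y} = Fintype.card {i // g i = y} := by
    intro y
    have := congrArg (Multiset.count y) h
    rw [Multiset.count_map, Multiset.count_map] at this
    simpa [Fintype.card_subtype, Finset.card_def, eq_comm] using this
  let E : (Σ y, {i // f i = y}) ≃ Σ y, {i // g i = y} :=
    Equiv.sigmaCongrRight fun y => Fintype.equivOfCardEq (hc y)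
  refine ⟨(Equiv.sigmaFiberEquiv f).symm.trans (E.trans (Equiv.sigmaFiberEquiv g)), fun i => ?_⟩
  exact (Fintype.equivOfCardEq (hc (f i)) ⟨i, rfl⟩).2.symm

theorem roots_prod_X_sub_C_eq_map {ι : Type*} [Fintype ι] (f : ι → ℝ) :
    (∏ i, (Polynomial.X - Polynomial.C (f i))).roots = Finset.univ.val.map f := by
  rw [← Polynomial.roots_multiset_prod_X_sub_C (Finset.univ.val.map f), Multiset.map_map]
  rfl

theorem eqUpToPermSign_of_prod_eq {k : ℕ} {θ θ' : Fin k → ℝ}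
    (h : ∏ i, (Polynomial.X - Polynomial.C (Real.cosh ((θ + θ) i))) =
      ∏ i, (Polynomial.X - Polynomial.C (Real.cosh ((θ' + θ') i)))) : EqUpToPermSign θ θ' := by
  have h' := congrArg Polynomial.roots h
  rw [roots_prod_X_sub_C_eq_map, roots_prod_X_sub_C_eq_map] at h'
  obtain ⟨σ, hσ⟩ := exists_perm_of_map_eq h'.symm
  have habs : ∀ i, θ' i = θ (σ i) ∨ θ' i = -θ (σ i) := by
    intro i
    have h1 := (Real.cosh_le_cosh.1 (hσ i).le).antisymm (Real.cosh_le_cosh.1 (hσ i).ge)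
    rcases abs_eq_abs.1 h1 with h2 | h2 <;> simp only [Pi.add_apply] at h2
    · left; linarith
    · right; linarith
  refine ⟨σ, fun i => if θ' i = θ (σ i) then 1 else -1, fun i => ?_⟩
  by_cases hi : θ' i = θ (σ i)
  · simp [hi]
  · beta_reduce
    rw [if_neg hi, (habs i).resolve_left hi]
    simp

theorem charpoly_signature_mul_congr {p q : ℕ} {V : Matrix (Fin p ⊕ Fin q) (Fin p ⊕ Fin q) ℝ}
    (hV : V ∈ indefiniteOrthogonal p q) (α : Fin p → ℝ) (δ : Fin q → ℝ) :
    (fromBlocks 1 0 0 (-1) * (Vᵀ * fromBlocks (diagonal α) 0 0 (diagonal δ) * V)).charpoly =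
      (∏ i, (Polynomial.X - Polynomial.C (α i))) *
        ∏ i, (Polynomial.X - Polynomial.C (-δ i)) := by
  have h := form_isometry_transpose (by simp [fromBlocks_multiply]) hV
  rw [transpose_transpose] at h
  rw [Matrix.mul_assoc Vᵀ, ← Matrix.mul_assoc, charpoly_mul_comm, Matrix.mul_assoc,
    ← Matrix.mul_assoc V, h, fromBlocks_multiply]
  simp [charpoly_diagonal]

theorem eqUpToPermSign_of_congr {a b c : ℕ} {θ θ' : Fin (min a b) → ℝ} {δ δ' : Fin c → ℝ}
    {V V' : Matrix (Fin a ⊕ Fin c) (Fin a ⊕ Fin c) ℝ} (hV : V ∈ indefiniteOrthogonal a c)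
    (hV' : V' ∈ indefiniteOrthogonal a c) (hδ : ∀ i, 0 ≤ δ i) (hδ' : ∀ i, 0 ≤ δ' i)
    (h : Vᵀ * fromBlocks (hyperbolicH a b (θ + θ)).toBlocks₁₁ 0 0 (diagonal δ) * V =
      V'ᵀ * fromBlocks (hyperbolicH a b (θ' + θ')).toBlocks₁₁ 0 0 (diagonal δ') * V') :
    EqUpToPermSign θ θ' := by
  rw [hyperbolicH_toBlocks₁₁, hyperbolicH_toBlocks₁₁] at h
  have hc := congrArg (fun M => (fromBlocks 1 0 0 (-1) * M).charpoly.roots.filter (0 < ·)) h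
  have hr : ∀ (φ : Fin (min a b) → ℝ) (ε : Fin c → ℝ), (∀ i, 0 ≤ ε i) →
      ((∏ i, (Polynomial.X - Polynomial.C
          (hyperbolicDiag φ (hyperbolicIndexEquiv a b (Sum.inl i))))) *
        ∏ i, (Polynomial.X - Polynomial.C (-ε i))).roots.filter (0 < ·) =
      Finset.univ.val.map fun i => hyperbolicDiag φ (hyperbolicIndexEquiv a b (Sum.inl i)) := by
    intro φ ε hε
    rw [Polynomial.roots_mul (mul_ne_zero
        (Finset.prod_ne_zero_iff.2 fun i _ => Polynomial.X_sub_C_ne_zero _)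
        (Finset.prod_ne_zero_iff.2 fun i _ => Polynomial.X_sub_C_ne_zero _)),
      roots_prod_X_sub_C_eq_map, roots_prod_X_sub_C_eq_map, Multiset.filter_add,
      Multiset.filter_eq_self.2, Multiset.filter_eq_nil.2, add_zero]
    · simp only [Multiset.mem_map]
      rintro _ ⟨i, -, rfl⟩
      simpa using hε i
    · simp only [Multiset.mem_map]
      rintro _ ⟨i, -, rfl⟩
      exact zero_lt_one.trans_le (one_le_hyperbolicDiag _ _)
  simp only [charpoly_signature_mul_congr hV, charpoly_signature_mul_congr hV'] at hc
  rw [hr _ _ hδ, hr _ _ hδ'] at hc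
  have hp := congrArg (fun s => (s.map fun x => Polynomial.X - Polynomial.C x).prod) hc
  simp only [Multiset.map_map] at hp
  have hp' := (prod_hyperbolicDiag (θ + θ) fun x => Polynomial.X - Polynomial.C x).symm.trans
    (Eq.trans hp (prod_hyperbolicDiag (θ' + θ') fun x => Polynomial.X - Polynomial.C x))
  exact eqUpToPermSign_of_prod_eq
    (mul_right_cancel₀ (pow_ne_zero _ (Polynomial.X_sub_C_ne_zero _)) hp')

theorem doubleH_eq (θ : Fin (min p₁ q₂) → ℝ) (γ : Fin (min p₂ q₁) → ℝ) :
    (doubleH θ γ).toBlocks₁₁ = fromBlocks (hyperbolicH p₁ q₂ θ).toBlocks₁₁ 0 0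
        (hyperbolicH p₂ q₁ γ).toBlocks₂₂ ∧
      (doubleH θ γ).toBlocks₂₂ = fromBlocks (hyperbolicH p₂ q₁ γ).toBlocks₁₁ 0 0
        (hyperbolicH p₁ q₂ θ).toBlocks₂₂ := by
  rw [doubleH, ← fromBlocks_toBlocks (hyperbolicH p₁ q₂ θ),
    ← fromBlocks_toBlocks (hyperbolicH p₂ q₁ γ), submatrix_regroupEquiv]
  exact ⟨rfl, rfl⟩

theorem toBlocks_congr {m n : Type*} [Fintype m] [Fintype n] (V : Matrix m m ℝ) (W : Matrix n n ℝ)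
    (M : Matrix (m ⊕ n) (m ⊕ n) ℝ) :
    ((fromBlocks V 0 0 W)ᵀ * M * fromBlocks V 0 0 W).toBlocks₁₁ = Vᵀ * M.toBlocks₁₁ * V ∧
      ((fromBlocks V 0 0 W)ᵀ * M * fromBlocks V 0 0 W).toBlocks₂₂ = Wᵀ * M.toBlocks₂₂ * W := by
  rw [← fromBlocks_toBlocks M]
  simp [fromBlocks_transpose, fromBlocks_multiply]

theorem eqUpToPermSign_of_hasFactorization
    {O : Matrix (Fin (p₁ + p₂) ⊕ Fin (q₁ + q₂)) (Fin (p₁ + p₂) ⊕ Fin (q₁ + q₂)) ℝ}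
    (hO : O ∈ indefiniteOrthogonal (p₁ + p₂) (q₁ + q₂))
    {θ θ' : Fin (min p₁ q₂) → ℝ} {γ γ' : Fin (min p₂ q₁) → ℝ} (h : HasFactorization O θ γ)
    (h' : HasFactorization O θ' γ') : EqUpToPermSign θ θ' ∧ EqUpToPermSign γ γ' := by
  rw [hasFactorization_iff_gram hO] at h h'
  obtain ⟨V₁, h₁, V₂, h₂, h⟩ := h
  obtain ⟨V₁', h₁', V₂', h₂', h'⟩ := h'
  have e := h.symm.trans h'
  have e₁ := congrArg toBlocks₁₁ e
  have e₂ := congrArg toBlocks₂₂ e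
  rw [(toBlocks_congr _ _ _).1, (toBlocks_congr _ _ _).1, (doubleH_eq _ _).1, (doubleH_eq _ _).1,
    hyperbolicH_toBlocks₂₂, hyperbolicH_toBlocks₂₂] at e₁
  rw [(toBlocks_congr _ _ _).2, (toBlocks_congr _ _ _).2, (doubleH_eq _ _).2, (doubleH_eq _ _).2,
    hyperbolicH_toBlocks₂₂, hyperbolicH_toBlocks₂₂] at e₂
  exact ⟨eqUpToPermSign_of_congr h₁ h₁'
      (fun _ => zero_le_one.trans (one_le_hyperbolicDiag _ _))
      (fun _ => zero_le_one.trans (one_le_hyperbolicDiag _ _)) e₁,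
    eqUpToPermSign_of_congr h₂ h₂'
      (fun _ => zero_le_one.trans (one_le_hyperbolicDiag _ _))
      (fun _ => zero_le_one.trans (one_le_hyperbolicDiag _ _)) e₂⟩

end factorization

theorem mainTheorem11 (p₁ p₂ q₁ q₂ : ℕ)
    (O : Matrix (Fin (p₁ + p₂) ⊕ Fin (q₁ + q₂)) (Fin (p₁ + p₂) ⊕ Fin (q₁ + q₂)) ℝ)
    (hO : O ∈ indefiniteOrthogonal (p₁ + p₂) (q₁ + q₂)) :
    ∃ (θ : Fin (min p₁ q₂) → ℝ) (γ : Fin (min p₂ q₁) → ℝ),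
      HasFactorization O θ γ ∧
      ∀ (θ' : Fin (min p₁ q₂) → ℝ) (γ' : Fin (min p₂ q₁) → ℝ),
        HasFactorization O θ' γ' ↔ EqUpToPermSign θ θ' ∧ EqUpToPermSign γ γ' := by
  obtain ⟨θ, γ, h⟩ := exists_hasFactorization hO
  exact ⟨θ, γ, h, fun θ' γ' => ⟨eqUpToPermSign_of_hasFactorization hO h,
    fun h' => hasFactorization_of_eqUpToPermSign hO h h'.1 h'.2⟩⟩
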